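/- Let $(M,g)$ be a compact connected smooth Riemannian manifold (without boundary) of dimension $n\ge 3$. Let $R$ be its Riemann curvature tensor, with the sign convention that $R_{ijij}$ is the sectional curvature of the plane spanned by two vectors $e_i,e_j$ ($i\neq j$) of an orthonormal basis, and suppose that $(M,g)$ has harmonic curvature, i.e. $\sum_{m}\nabla_m R_{mjkl}=0$ in orthonormal frames. At a point with tangent space $V$ and orthonormal basis $e_1,\dots,e_n$, let $\bar R\colon S^2(V)\to S^2(V)$ be the linear operator with $\bar R(e_i\odot e_j)=\sum_{k,l}R_{kijl}\,e_k\odot e_l$, where $e_i\odot e_j=e_i\otimes e_j+e_j\otimes e_i$, and let the curvature operator of the second kind be $\mathring R=\mathrm{pr}_{S^2_0(V)}\circ\bar R|_{S^2_0(V)}$, a self-adjoint operator on the space $S^2_0(V)$ of trace-free symmetric 2-tensors. Let $\lambda_1\le\lambda_2\le\dots\le\lambda_N$, $N=\frac{(n-1)(n+2)}{2}$, be its eigenvalues, listed with multiplicity. For a real number $1\le k<N$ one says that $\mathring R$ is $k$-nonnegative if at every point of $M$ $$\lambda_1+\dots+\lambda_{\lfloor k\rfloor}+(k-\lfloor k\rfloor)\,\lambda_{\lfloor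 k\rfloor+1}\ \ge\ 0 .$$ If $\mathring R$ is $\frac{n(n+2)}{2(n+1)}$-nonnegative, then $(M,g)$ is Einstein: there is a constant $c\in\mathbb R$ with $\mathrm{Ric}=c\,g$ on $M$. -/

import Mathlib

open scoped Manifold ContDiff

noncomputable section

namespace HarmonicCurvature

/-! ### Local Riemannian geometry of a matrix-valued function `G = (g_ij)` on `ℝⁿ` -/

section Coordinates

variable {n : ℕ}

/-- The `i`-th partial derivative of `f` at `y`. -/
def partialDeriv (i : Fin n) (f : EuclideanSpace ℝ (Fin n) → ℝ)
    (y : EuclideanSpace ℝ (Fin n)) : ℝ :=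
  fderiv ℝ f y (EuclideanSpace.single i 1)

variable (G : EuclideanSpace ℝ (Fin n) → Matrix (Fin n) (Fin n) ℝ)

/-- The Christoffel symbols `Γ^k_ij` of the Levi-Civita connection. -/
def christoffel (i j k : Fin n) (y : EuclideanSpace ℝ (Fin n)) : ℝ :=
  (1 / 2) * ∑ l, (G y)⁻¹ k l *
    (partialDeriv i (fun z => G z j l) y + partialDeriv j (fun z => G z i l) y
      - partialDeriv l (fun z => G z i j) y)

/-- The coefficients of `R(∂_i, ∂_j) ∂_k = ∑ l, (curvatureUp G i j k l) ∂_l`, where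
`R(X, Y) Z = ∇_X ∇_Y Z - ∇_Y ∇_X Z - ∇_[X, Y] Z`. -/
def curvatureUp (i j k l : Fin n) (y : EuclideanSpace ℝ (Fin n)) : ℝ :=
  partialDeriv i (christoffel G j k l) y - partialDeriv j (christoffel G i k l) y
    + ∑ m, (christoffel G i m l y * christoffel G j k m y
      - christoffel G j m l y * christoffel G i k m y)

/-- The curvature tensor `R_ijkl = g(R(∂_i, ∂_j) ∂_l, ∂_k)`, with the sign for which `R_ijij` is the
sectional curvature in an orthonormal frame. -/
def curvature (i j k l : Fin n) (y : EuclideanSpace ℝ (Fin n)) : ℝ :=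
  ∑ m, G y k m * curvatureUp G i j l m y

/-- The Ricci tensor `Ric_ik = g^jl R_ijkl`. -/
def ricci (i k : Fin n) (y : EuclideanSpace ℝ (Fin n)) : ℝ :=
  ∑ j, ∑ l, (G y)⁻¹ j l * curvature G i j k l y

/-- The covariant derivative `∇_m R_ijkl` of the curvature tensor. -/
def nablaCurvature (m i j k l : Fin n) (y : EuclideanSpace ℝ (Fin n)) : ℝ :=
  partialDeriv m (curvature G i j k l) y
    - ∑ p, (christoffel G m i p y * curvature G p j k l y
      + christoffel G m j p y * curvature G i p k l y
      + christoffel G m k p y * curvature G i j p l y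
      + christoffel G m l p y * curvature G i j k p y)

/-- The divergence `g^mi ∇_m R_ijkl` of the curvature tensor. -/
def divCurvature (j k l : Fin n) (y : EuclideanSpace ℝ (Fin n)) : ℝ :=
  ∑ m, ∑ i, (G y)⁻¹ m i * nablaCurvature G m i j k l y

/-- The components `R(e_a, e_b, e_c, e_d)` of the curvature tensor at `y` in the frame
`e_a = ∑ i, A i a ∂_i`. -/
def frameCurvature (A : Matrix (Fin n) (Fin n) ℝ) (y : EuclideanSpace ℝ (Fin n))
    (a b c d : Fin n) : ℝ :=
  ∑ i, ∑ j, ∑ k, ∑ l, A i a * A j b * A k c * A l d * curvature G i j k l y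

end Coordinates

/-! ### The curvature operator of the second kind in an orthonormal frame -/

section Algebra

variable {n : ℕ}

/-- Trace-free symmetric 2-tensors, in components with respect to an orthonormal frame. -/
def tracelessSym (n : ℕ) : Submodule ℝ (Matrix (Fin n) (Fin n) ℝ) where
  carrier := {h | h.IsSymm ∧ h.trace = 0}
  add_mem' := fun ha hb => ⟨ha.1.add hb.1, by simp [Matrix.trace_add, ha.2, hb.2]⟩
  zero_mem' := ⟨Matrix.isSymm_zero, by simp⟩
  smul_mem' := fun c _ ha => ⟨ha.1.smul c, by simp [Matrix.trace_smul, ha.2]⟩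

/-- The operator determined on symmetric 2-tensors by
`e_i ⊙ e_j ↦ ∑ k l, R_kijl e_k ⊙ e_l`, where `u ⊙ v = u ⊗ v + v ⊗ u`; a symmetric `h` is
`(1 / 2) ∑ i j, h_ij e_i ⊙ e_j`. -/
def rBar (R : Fin n → Fin n → Fin n → Fin n → ℝ) :
    Matrix (Fin n) (Fin n) ℝ →ₗ[ℝ] Matrix (Fin n) (Fin n) ℝ where
  toFun h := Matrix.of fun k l => (1 / 2) * ∑ i, ∑ j, (R k i j l + R l i j k) * h i j
  map_add' h h' := by
    ext k l
    simp [mul_add, Finset.sum_add_distrib]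
  map_smul' c h := by
    ext k l
    simp only [Matrix.smul_apply, Matrix.of_apply, smul_eq_mul, RingHom.id_apply, Finset.mul_sum]
    refine Finset.sum_congr rfl fun i _ => Finset.sum_congr rfl fun j _ => ?_
    ring

/-- The orthogonal projection `T ↦ T - (tr T / n) g` from symmetric to trace-free symmetric
2-tensors, in components with respect to an orthonormal frame. -/
def removeTrace (n : ℕ) : Matrix (Fin n) (Fin n) ℝ →ₗ[ℝ] Matrix (Fin n) (Fin n) ℝ where
  toFun T := T - (T.trace / n) • (1 : Matrix (Fin n) (Fin n) ℝ)
  map_add' T T' := by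
    rw [Matrix.trace_add, add_div, add_smul]
    abel
  map_smul' c T := by
    rw [Matrix.trace_smul, RingHom.id_apply, smul_sub, smul_smul, smul_eq_mul, mul_div_assoc]

lemma removeTrace_rBar_mem (R : Fin n → Fin n → Fin n → Fin n → ℝ)
    (h : Matrix (Fin n) (Fin n) ℝ) : removeTrace n (rBar R h) ∈ tracelessSym n := by
  have hs : (rBar R h).IsSymm := by
    ext k l
    simp [rBar, add_comm]
  refine ⟨hs.sub (Matrix.isSymm_one.smul _), ?_⟩
  rcases Nat.eq_zero_or_pos n with rfl | hn
  · simp [Matrix.trace]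
  · have hn' : (n : ℝ) ≠ 0 := by exact_mod_cast hn.ne'
    simp [removeTrace, Matrix.trace_sub, Matrix.trace_smul, Matrix.trace_one, hn']

/-- The curvature operator of the second kind: `rBar` restricted to trace-free symmetric 2-tensors,
followed by the projection onto them. -/
def secondKind (R : Fin n → Fin n → Fin n → Fin n → ℝ) : Module.End ℝ (tracelessSym n) :=
  ((removeTrace n ∘ₗ rBar R) ∘ₗ (tracelessSym n).subtype).codRestrict (tracelessSym n)
    fun h => removeTrace_rBar_mem R h

/-- The eigenvalues of an endomorphism, with multiplicity, in non-decreasing order. -/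
def orderedEigenvalues {V : Type*} [AddCommGroup V] [Module ℝ V] [Module.Finite ℝ V]
    (T : Module.End ℝ V) : List ℝ :=
  T.charpoly.roots.sort (· ≤ ·)

/-- `T` is `k`-nonnegative: `λ_1 + ⋯ + λ_[k] + (k - [k]) λ_([k]+1) ≥ 0` for its ordered eigenvalues
(list positions start at `0`). -/
def IsKNonnegative {V : Type*} [AddCommGroup V] [Module ℝ V] [Module.Finite ℝ V]
    (k : ℝ) (T : Module.End ℝ V) : Prop :=
  0 ≤ ((orderedEigenvalues T).take ⌊k⌋₊).sum
    + (k - ⌊k⌋₊) * (orderedEigenvalues T).getD ⌊k⌋₊ 0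

end Algebra

/-! ### Riemannian manifolds -/

section Manifold

variable {n : ℕ} {M : Type*} [TopologicalSpace M] [ChartedSpace (EuclideanSpace ℝ (Fin n)) M]
  [IsManifold (𝓡 n) ∞ M]

/-- The components `g_ij = g(∂_i, ∂_j)` of the metric in a chart, as functions on its target. -/
def metricCoeff
    (g : Bundle.ContMDiffRiemannianMetric (𝓡 n) ∞ (EuclideanSpace ℝ (Fin n))
      (TangentSpace (𝓡 n) : M → Type _))
    (φ : OpenPartialHomeomorph M (EuclideanSpace ℝ (Fin n))) (y : EuclideanSpace ℝ (Fin n)) :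
    Matrix (Fin n) (Fin n) ℝ :=
  Matrix.of fun i j => g.inner (φ.symm y)
    (mfderiv (𝓡 n) (𝓡 n) φ.symm y (EuclideanSpace.single i (1 : ℝ)))
    (mfderiv (𝓡 n) (𝓡 n) φ.symm y (EuclideanSpace.single j (1 : ℝ)))

variable
  (g : Bundle.ContMDiffRiemannianMetric (𝓡 n) ∞ (EuclideanSpace ℝ (Fin n))
    (TangentSpace (𝓡 n) : M → Type _))

/-- Harmonic curvature: the curvature tensor is divergence free (in every smooth chart). -/
def HasHarmonicCurvature : Prop :=
  ∀ φ ∈ IsManifold.maximalAtlas (𝓡 n) ∞ M, ∀ y ∈ φ.target, ∀ j k l,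
    divCurvature (metricCoeff g φ) j k l y = 0

/-- The curvature operator of the second kind is `k`-nonnegative at every point; it is computed in
orthonormal frames `e_a = ∑ i, A i a ∂_i`, i.e. `Aᵀ G A = 1`. -/
def SecondKindKNonnegative (k : ℝ) : Prop :=
  ∀ φ ∈ IsManifold.maximalAtlas (𝓡 n) ∞ M, ∀ y ∈ φ.target,
    ∀ A : Matrix (Fin n) (Fin n) ℝ, A.transpose * metricCoeff g φ y * A = 1 →
      IsKNonnegative k (secondKind (frameCurvature (metricCoeff g φ) A y))

/-- Einstein metrics: `Ric = c g` for a constant `c`. -/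
def IsEinstein : Prop :=
  ∃ c : ℝ, ∀ φ ∈ IsManifold.maximalAtlas (𝓡 n) ∞ M, ∀ y ∈ φ.target, ∀ i j,
    ricci (metricCoeff g φ) i j y = c * metricCoeff g φ y i j

end Manifold

end HarmonicCurvature

end

noncomputable section

namespace HarmonicCurvature

/-! ### Partial derivatives of smooth functions and of matrix-valued functions -/

section Calculus

variable {n : ℕ} {U : Set (EuclideanSpace ℝ (Fin n))} {y : EuclideanSpace ℝ (Fin n)}

/-! The argument is the maximum principle for |Ric|², closed by a weighted eigenvalue estimate.

Geometry. The contracted second Bianchi identity (`divCurvature_eq`) writes the divergence of the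
curvature as the antisymmetrized derivative of Ric. Harmonic curvature therefore makes ∇Ric totally
symmetric (`codazzi`), and a further trace makes the scalar curvature S locally constant. Commuting
derivatives then gives a Bochner formula: half the Laplacian of |Ric|² is |∇Ric|² plus half of Q = ∑
R_ijij (ρ_i - ρ_j)², where the ρ_i are the Ricci eigenvalues. On compact M the function |Ric|²
attains a maximum, and there Q ≤ 0 (`bochner_nonpos_of_isLocalMax`).

Algebra at the maximum point (`ricci_eigenvalues_eq`). Put ν_i = ρ_i - S/n, h = diag(ν), W = |h|².
Then Q/2 = ⟨R̊h, h⟩ + ∑ ρ_i ν_i². Each ρ_i is half the sum over j ≠ i of ⟨R̊(e_i ⊙ e_j), e_i ⊙ e_j⟩,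
so Q/2 is a combination, with weights 1 and ν_i²/2, of values of the quadratic form of R̊. In an
eigenbasis of R̊ it becomes ∑ v_α λ_α. The total mass ∑ v_α is nW, from W for h and (n - 1)W for the
pairs; and 0 ≤ v_α ≤ W, by Cauchy-Schwarz on the diagonal and ν_i² + ν_j² ≤ W off it. If k < n, then
k-nonnegativity together with ∑ v_α λ_α ≤ 0 forces every λ_α ≥ 0 (`nonneg_of_weighted_sum_nonpos`).
Sectional and Ricci curvatures are then nonnegative, so both parts of Q/2 vanish, ρ_i ν_i = 0 for
all i, and W = ∑ ρ_i ν_i = 0. Since n(n+2)/(2(n+1)) < n, the theorem is a special case.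

Globalization. At the maximum |Ric|² = S²/n. Since S is constant on connected M, |Ric|² ≤ S²/n
everywhere, which is the equality case of Cauchy-Schwarz and gives Ric = (S/n) g
(`eq_smul_of_trace_sq_le`). Everything local is computed with matrices in charts; the tensor
transformation laws make S and |Ric|² functions on M. -/

lemma differentiableAt_of_contDiffOn {f : EuclideanSpace ℝ (Fin n) → ℝ}
    (hU : IsOpen U) (hf : ContDiffOn ℝ ∞ f U) (hy : y ∈ U) : DifferentiableAt ℝ f y :=
  (hf.contDiffAt (hU.mem_nhds hy)).differentiableAt (by simp)

lemma partialDeriv_congr {f g : EuclideanSpace ℝ (Fin n) → ℝ} (hU : IsOpen U)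
    (h : ∀ z ∈ U, f z = g z) (hy : y ∈ U) (i : Fin n) :
    partialDeriv i f y = partialDeriv i g y := by
  have : f =ᶠ[nhds y] g := Filter.eventuallyEq_of_mem (hU.mem_nhds hy) h
  rw [partialDeriv, partialDeriv, this.fderiv_eq]

lemma contDiffOn_partialDeriv {f : EuclideanSpace ℝ (Fin n) → ℝ} (hU : IsOpen U)
    (hf : ContDiffOn ℝ ∞ f U) (i : Fin n) : ContDiffOn ℝ ∞ (partialDeriv i f) U :=
  (hf.fderiv_of_isOpen hU (m := ∞) (by simp)).clm_apply contDiffOn_const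

lemma partialDeriv_comm {f : EuclideanSpace ℝ (Fin n) → ℝ} (hU : IsOpen U)
    (hf : ContDiffOn ℝ ∞ f U) (hy : y ∈ U) (i j : Fin n) :
    partialDeriv i (partialDeriv j f) y = partialDeriv j (partialDeriv i f) y := by
  have hf' : ContDiffAt ℝ ∞ f y := hf.contDiffAt (hU.mem_nhds hy)
  have hd : DifferentiableAt ℝ (fderiv ℝ f) y :=
    ((hf.fderiv_of_isOpen hU (m := ∞) (by simp)).contDiffAt (hU.mem_nhds hy)).differentiableAt
      (by simp)
  have key : ∀ a b : Fin n, partialDeriv a (partialDeriv b f) y =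
      fderiv ℝ (fderiv ℝ f) y (EuclideanSpace.single a 1) (EuclideanSpace.single b 1) := by
    intro a b
    change fderiv ℝ (fun z => fderiv ℝ f z (EuclideanSpace.single b 1)) y _ = _
    rw [fderiv_clm_apply hd (differentiableAt_const _)]
    simp
  rw [key, key]
  have hs : IsSymmSndFDerivAt ℝ f y := hf'.isSymmSndFDerivAt (by
    rw [minSmoothness_of_isRCLikeNormedField]
    exact WithTop.coe_le_coe.2 (le_top : (2 : ℕ∞) ≤ ⊤))
  exact hs _ _

lemma fderiv_apply_eq_sum_partialDeriv (f : EuclideanSpace ℝ (Fin n) → ℝ)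
    (y v : EuclideanSpace ℝ (Fin n)) :
    fderiv ℝ f y v = ∑ i, v i * partialDeriv i f y := by
  have hv : v = ∑ i, v i • EuclideanSpace.single i (1 : ℝ) := by
    ext j
    simp [Finset.sum_apply, Pi.single_apply]
  conv_lhs => rw [hv]
  simp [partialDeriv]

/-- Smoothness of all entries of a matrix-valued function on `U`. -/
def SmoothMat (U : Set (EuclideanSpace ℝ (Fin n)))
    (X : EuclideanSpace ℝ (Fin n) → Matrix (Fin n) (Fin n) ℝ) : Prop :=
  ∀ a b, ContDiffOn ℝ ∞ (fun z => X z a b) U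

/-- Entrywise partial derivative of a matrix-valued function. -/
def dMat (i : Fin n) (X : EuclideanSpace ℝ (Fin n) → Matrix (Fin n) (Fin n) ℝ)
    (y : EuclideanSpace ℝ (Fin n)) : Matrix (Fin n) (Fin n) ℝ :=
  Matrix.of fun a b => partialDeriv i (fun z => X z a b) y

variable {X Y : EuclideanSpace ℝ (Fin n) → Matrix (Fin n) (Fin n) ℝ}

lemma SmoothMat.congr (hX : SmoothMat U X) (h : ∀ z ∈ U, Y z = X z) : SmoothMat U Y :=
  fun a b => (hX a b).congr fun z hz => by rw [h z hz]

lemma SmoothMat.add (hX : SmoothMat U X) (hY : SmoothMat U Y) :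
    SmoothMat U (fun z => X z + Y z) := fun a b => (hX a b).add (hY a b)

lemma SmoothMat.sub (hX : SmoothMat U X) (hY : SmoothMat U Y) :
    SmoothMat U (fun z => X z - Y z) := fun a b => (hX a b).sub (hY a b)

lemma SmoothMat.transpose (hX : SmoothMat U X) : SmoothMat U (fun z => (X z).transpose) :=
  fun a b => hX b a

lemma SmoothMat.mul (hX : SmoothMat U X) (hY : SmoothMat U Y) :
    SmoothMat U (fun z => X z * Y z) := fun a b => by
  simp only [Matrix.mul_apply]
  exact ContDiffOn.sum fun k _ => (hX a k).mul (hY k b)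

lemma SmoothMat.const (C : Matrix (Fin n) (Fin n) ℝ) : SmoothMat U (fun _ => C) :=
  fun _ _ => contDiffOn_const

lemma SmoothMat.smul {f : EuclideanSpace ℝ (Fin n) → ℝ} (hf : ContDiffOn ℝ ∞ f U)
    (hX : SmoothMat U X) : SmoothMat U (fun z => f z • X z) :=
  fun a b => hf.mul (hX a b)

lemma SmoothMat.sum {ι : Type*} {s : Finset ι}
    {Z : ι → EuclideanSpace ℝ (Fin n) → Matrix (Fin n) (Fin n) ℝ}
    (hZ : ∀ k, SmoothMat U (Z k)) : SmoothMat U (fun z => ∑ k ∈ s, Z k z) := fun a b => by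
  simp only [Matrix.sum_apply]
  exact ContDiffOn.sum fun k _ => hZ k a b

lemma SmoothMat.trace (hX : SmoothMat U X) : ContDiffOn ℝ ∞ (fun z => (X z).trace) U := by
  simp only [Matrix.trace, Matrix.diag]
  exact ContDiffOn.sum fun k _ => hX k k

lemma SmoothMat.det (hX : SmoothMat U X) : ContDiffOn ℝ ∞ (fun z => (X z).det) U := by
  simp only [Matrix.det_apply]
  exact ContDiffOn.sum fun σ _ => (contDiffOn_prod fun i _ => hX _ _).const_smul _

lemma SmoothMat.inv (hX : SmoothMat U X) (h : ∀ z ∈ U, (X z).det ≠ 0) :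
    SmoothMat U (fun z => (X z)⁻¹) := fun a b => by
  simp only [Matrix.inv_def, Matrix.smul_apply, Ring.inverse_eq_inv', smul_eq_mul,
    Matrix.adjugate_apply]
  -- An adjugate entry is the determinant of `X` with one row replaced by a constant row, so
  -- smoothness of determinants suffices.
  refine (hX.det.inv h).mul (SmoothMat.det fun c d => ?_)
  by_cases hc : c = b
  · subst hc
    simpa using contDiffOn_const
  · simpa [Matrix.updateRow_ne hc] using hX c d

lemma SmoothMat.dMat (hU : IsOpen U) (hX : SmoothMat U X) (i : Fin n) :
    SmoothMat U (dMat i X) := fun a b => contDiffOn_partialDeriv hU (hX a b) i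

lemma dMat_congr (hU : IsOpen U) (h : ∀ z ∈ U, X z = Y z) (hy : y ∈ U) (i : Fin n) :
    dMat i X y = dMat i Y y := by
  ext a b
  exact partialDeriv_congr hU (fun z hz => by rw [h z hz]) hy i

lemma dMat_comm (hU : IsOpen U) (hX : SmoothMat U X) (hy : y ∈ U) (i j : Fin n) :
    dMat i (dMat j X) y = dMat j (dMat i X) y := by
  ext a b
  exact partialDeriv_comm hU (hX a b) hy i j

lemma dMat_add (hU : IsOpen U) (hX : SmoothMat U X) (hY : SmoothMat U Y) (hy : y ∈ U)
    (i : Fin n) : dMat i (fun z => X z + Y z) y = dMat i X y + dMat i Y y := by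
  ext a b
  simp only [dMat, Matrix.of_apply, Matrix.add_apply, partialDeriv]
  rw [fderiv_fun_add (differentiableAt_of_contDiffOn hU (hX a b) hy)
    (differentiableAt_of_contDiffOn hU (hY a b) hy)]
  simp

lemma dMat_sub (hU : IsOpen U) (hX : SmoothMat U X) (hY : SmoothMat U Y) (hy : y ∈ U)
    (i : Fin n) : dMat i (fun z => X z - Y z) y = dMat i X y - dMat i Y y := by
  ext a b
  simp only [dMat, Matrix.of_apply, Matrix.sub_apply, partialDeriv]
  rw [fderiv_fun_sub (differentiableAt_of_contDiffOn hU (hX a b) hy)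
    (differentiableAt_of_contDiffOn hU (hY a b) hy)]
  simp

lemma dMat_transpose (i : Fin n) :
    dMat i (fun z => (X z).transpose) y = (dMat i X y).transpose := rfl

lemma dMat_const (C : Matrix (Fin n) (Fin n) ℝ) (i : Fin n) :
    dMat i (fun _ => C) y = 0 := by
  ext a b
  simp [dMat, partialDeriv]

lemma partialDeriv_sum {ι : Type*} {s : Finset ι} {f : ι → EuclideanSpace ℝ (Fin n) → ℝ}
    (hU : IsOpen U) (hf : ∀ k, ContDiffOn ℝ ∞ (f k) U) (hy : y ∈ U) (i : Fin n) :
    partialDeriv i (fun z => ∑ k ∈ s, f k z) y = ∑ k ∈ s, partialDeriv i (f k) y := by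
  simp only [partialDeriv]
  rw [fderiv_fun_sum fun k _ => differentiableAt_of_contDiffOn hU (hf k) hy]
  simp

lemma partialDeriv_mul {f g : EuclideanSpace ℝ (Fin n) → ℝ} (hU : IsOpen U)
    (hf : ContDiffOn ℝ ∞ f U) (hg : ContDiffOn ℝ ∞ g U) (hy : y ∈ U) (i : Fin n) :
    partialDeriv i (fun z => f z * g z) y
      = partialDeriv i f y * g y + f y * partialDeriv i g y := by
  simp only [partialDeriv]
  rw [fderiv_fun_mul (differentiableAt_of_contDiffOn hU hf hy)
    (differentiableAt_of_contDiffOn hU hg hy)]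
  simp
  ring

lemma dMat_mul (hU : IsOpen U) (hX : SmoothMat U X) (hY : SmoothMat U Y) (hy : y ∈ U)
    (i : Fin n) : dMat i (fun z => X z * Y z) y = dMat i X y * Y y + X y * dMat i Y y := by
  ext a b
  simp only [dMat, Matrix.of_apply, Matrix.add_apply, Matrix.mul_apply]
  rw [partialDeriv_sum hU (fun k => (hX a k).mul (hY k b)) hy, ← Finset.sum_add_distrib]
  exact Finset.sum_congr rfl fun k _ => partialDeriv_mul hU (hX a k) (hY k b) hy i

lemma dMat_smul {f : EuclideanSpace ℝ (Fin n) → ℝ} (hU : IsOpen U) (hf : ContDiffOn ℝ ∞ f U)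
    (hX : SmoothMat U X) (hy : y ∈ U) (i : Fin n) :
    dMat i (fun z => f z • X z) y = partialDeriv i f y • X y + f y • dMat i X y := by
  ext a b
  exact partialDeriv_mul hU hf (hX a b) hy i

lemma dMat_sum {ι : Type*} {s : Finset ι}
    {Z : ι → EuclideanSpace ℝ (Fin n) → Matrix (Fin n) (Fin n) ℝ}
    (hU : IsOpen U) (hZ : ∀ k, SmoothMat U (Z k)) (hy : y ∈ U) (i : Fin n) :
    dMat i (fun z => ∑ k ∈ s, Z k z) y = ∑ k ∈ s, dMat i (Z k) y := by
  ext a b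
  simp only [dMat, Matrix.of_apply, Matrix.sum_apply]
  exact partialDeriv_sum hU (fun k => hZ k a b) hy i

lemma partialDeriv_trace (hU : IsOpen U) (hX : SmoothMat U X) (hy : y ∈ U) (i : Fin n) :
    partialDeriv i (fun z => (X z).trace) y = (dMat i X y).trace := by
  simp only [Matrix.trace, Matrix.diag]
  exact partialDeriv_sum hU (fun k => hX k k) hy i

/-- At a local maximum the pure second partial derivatives are nonpositive. -/
lemma partialDeriv_partialDeriv_nonpos {f : EuclideanSpace ℝ (Fin n) → ℝ} (hU : IsOpen U)
    (hf : ContDiffOn ℝ ∞ f U) (hy : y ∈ U) (hmax : IsLocalMax f y) (i : Fin n) :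
    partialDeriv i (partialDeriv i f) y ≤ 0 := by
  by_contra! hpos
  set e : EuclideanSpace ℝ (Fin n) := EuclideanSpace.single i 1 with he
  set γ : ℝ → EuclideanSpace ℝ (Fin n) := fun t => y + t • e with hγ
  have hγc : Continuous γ := by fun_prop
  have hγ0 : γ 0 = y := by simp [hγ]
  have hγd : ∀ t, HasDerivAt γ e t := fun t =>
    (((hasDerivAt_id t).smul_const e).const_add y).congr_deriv (by simp)
  have hev : ∀ᶠ t in nhds (0 : ℝ), γ t ∈ U :=
    hγc.continuousAt.eventually_mem (by rw [hγ0]; exact hU.mem_nhds hy)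
  have hd : ∀ {φ : EuclideanSpace ℝ (Fin n) → ℝ} (_ : ContDiffOn ℝ ∞ φ U) (t : ℝ), γ t ∈ U →
      HasDerivAt (φ ∘ γ) (partialDeriv i φ (γ t)) t := fun hφ t ht =>
    (differentiableAt_of_contDiffOn hU hφ ht).hasFDerivAt.comp_hasDerivAt t (hγd t)
  have h1 : deriv (f ∘ γ) =ᶠ[nhds 0] partialDeriv i f ∘ γ := by
    filter_upwards [hev] with t ht using (hd hf t ht).deriv
  have h2 : deriv (deriv (f ∘ γ)) 0 = partialDeriv i (partialDeriv i f) y := by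
    rw [h1.deriv_eq, (hd (contDiffOn_partialDeriv hU hf i) 0 (by rwa [hγ0])).deriv, hγ0]
  have hm : IsLocalMax (f ∘ γ) 0 := by
    have : ∀ᶠ t in nhds (0 : ℝ), f (γ t) ≤ f y :=
      hγc.continuousAt.eventually (by rw [hγ0]; exact hmax)
    simpa [IsLocalMax, IsMaxFilter, hγ0] using this
  have hcont : ContinuousAt (f ∘ γ) 0 := (hd hf 0 (by rwa [hγ0])).continuousAt
  have hd0 : deriv (f ∘ γ) 0 = 0 := hm.deriv_eq_zero
  -- a critical point with positive second derivative is also a local minimum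
  have hmin := isLocalMin_of_deriv_deriv_pos (by rw [h2]; exact hpos) hd0 hcont
  have hconst : f ∘ γ =ᶠ[nhds 0] fun _ => (f ∘ γ) 0 := by
    filter_upwards [hm, hmin] with t h₁ h₂ using le_antisymm h₁ h₂
  have h3 : deriv (f ∘ γ) =ᶠ[nhds 0] fun _ => 0 := by
    filter_upwards [hconst.eventuallyEq_nhds] with t ht
    rw [ht.deriv_eq, deriv_const]
  have h4 : deriv (deriv (f ∘ γ)) 0 = 0 := by rw [h3.deriv_eq, deriv_const]
  rw [h2] at h4
  exact hpos.ne' h4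

end Calculus

/-! ### The Levi-Civita connection and its curvature in matrix form -/

section LocalGeometry

variable {n : ℕ} {U : Set (EuclideanSpace ℝ (Fin n))} {y : EuclideanSpace ℝ (Fin n)}
  {G : EuclideanSpace ℝ (Fin n) → Matrix (Fin n) (Fin n) ℝ}

/-- `G` is a smooth, symmetric and nondegenerate matrix-valued function on the open set `U`. -/
structure IsMetricOn (U : Set (EuclideanSpace ℝ (Fin n)))
    (G : EuclideanSpace ℝ (Fin n) → Matrix (Fin n) (Fin n) ℝ) : Prop where
  isOpen : IsOpen U
  smooth : SmoothMat U G
  symm : ∀ y ∈ U, (G y).IsSymm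
  det_ne : ∀ y ∈ U, (G y).det ≠ 0

variable (G) in
/-- The matrix `(Γ_i)_lm = Γ^l_im` of the Levi-Civita connection. -/
def chrMat (i : Fin n) (y : EuclideanSpace ℝ (Fin n)) : Matrix (Fin n) (Fin n) ℝ :=
  Matrix.of fun l m => christoffel G i m l y

variable (G) in
/-- The matrix of the Christoffel symbols of the first kind. -/
def lowChrMat (i : Fin n) (y : EuclideanSpace ℝ (Fin n)) : Matrix (Fin n) (Fin n) ℝ :=
  Matrix.of fun l m => (1 / 2) * (partialDeriv i (fun z => G z m l) y
    + partialDeriv m (fun z => G z i l) y - partialDeriv l (fun z => G z i m) y)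

variable (G) in
/-- The matrix of the curvature endomorphism `R(∂_i, ∂_j)`. -/
def curvMat (i j : Fin n) (y : EuclideanSpace ℝ (Fin n)) : Matrix (Fin n) (Fin n) ℝ :=
  Matrix.of fun l k => curvatureUp G i j k l y

variable (G) in
/-- The matrix of the Ricci tensor. -/
def ricMat (y : EuclideanSpace ℝ (Fin n)) : Matrix (Fin n) (Fin n) ℝ :=
  Matrix.of fun i k => ricci G i k y

variable (G) in
/-- Covariant derivative of a field of endomorphisms. -/
def covEnd (m : Fin n) (X : EuclideanSpace ℝ (Fin n) → Matrix (Fin n) (Fin n) ℝ)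
    (y : EuclideanSpace ℝ (Fin n)) : Matrix (Fin n) (Fin n) ℝ :=
  dMat m X y + chrMat G m y * X y - X y * chrMat G m y

variable (G) in
/-- Covariant derivative of a covariant 2-tensor. -/
def covForm (m : Fin n) (h : EuclideanSpace ℝ (Fin n) → Matrix (Fin n) (Fin n) ℝ)
    (y : EuclideanSpace ℝ (Fin n)) : Matrix (Fin n) (Fin n) ℝ :=
  dMat m h y - (chrMat G m y).transpose * h y - h y * chrMat G m y

variable (G) in
/-- Covariant derivative of the curvature, as an endomorphism-valued tensor. -/
def covCurv (m i j : Fin n) (y : EuclideanSpace ℝ (Fin n)) : Matrix (Fin n) (Fin n) ℝ :=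
  covEnd G m (curvMat G i j) y - ∑ p, chrMat G m y p i • curvMat G p j y
    - ∑ p, chrMat G m y p j • curvMat G i p y

lemma chrMat_eq (i : Fin n) (y : EuclideanSpace ℝ (Fin n)) :
    chrMat G i y = (G y)⁻¹ * lowChrMat G i y := by
  ext l m
  simp only [chrMat, lowChrMat, christoffel, Matrix.of_apply, Matrix.mul_apply, Finset.mul_sum]
  exact Finset.sum_congr rfl fun k _ => by ring

lemma curvMat_eq (i j : Fin n) (y : EuclideanSpace ℝ (Fin n)) :
    curvMat G i j y = dMat i (chrMat G j) y - dMat j (chrMat G i) y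
      + (chrMat G i y * chrMat G j y - chrMat G j y * chrMat G i y) := by
  ext l k
  simp only [curvMat, curvatureUp, Matrix.of_apply, Matrix.add_apply, Matrix.sub_apply,
    Matrix.mul_apply, Finset.sum_sub_distrib]
  rfl

lemma curvature_eq (i j k l : Fin n) (y : EuclideanSpace ℝ (Fin n)) :
    curvature G i j k l y = (G y * curvMat G i j y) k l := by
  simp [curvature, Matrix.mul_apply, curvMat]

lemma curvMat_swap (i j : Fin n) (y : EuclideanSpace ℝ (Fin n)) :
    curvMat G i j y = -curvMat G j i y := by
  rw [curvMat_eq, curvMat_eq]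
  abel

lemma curvature_swap_left (i j k l : Fin n) :
    curvature G i j k l y = -curvature G j i k l y := by
  rw [curvature_eq, curvature_eq, curvMat_swap, mul_neg, Matrix.neg_apply]

namespace IsMetricOn

variable (hG : IsMetricOn U G)
include hG

lemma isUnit_det (hy : y ∈ U) : IsUnit (G y).det := (hG.det_ne y hy).isUnit

lemma partialDeriv_symm (hy : y ∈ U) (k i j : Fin n) :
    partialDeriv k (fun z => G z i j) y = partialDeriv k (fun z => G z j i) y :=
  partialDeriv_congr hG.isOpen (fun z hz => (hG.symm z hz).apply j i) hy k

lemma smooth_inv : SmoothMat U (fun z => (G z)⁻¹) := hG.smooth.inv hG.det_ne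

lemma smooth_lowChrMat (i : Fin n) : SmoothMat U (lowChrMat G i) := fun l m =>
  contDiffOn_const.mul (((contDiffOn_partialDeriv hG.isOpen (hG.smooth m l) i).add
    (contDiffOn_partialDeriv hG.isOpen (hG.smooth i l) m)).sub
    (contDiffOn_partialDeriv hG.isOpen (hG.smooth i m) l))

lemma smooth_chrMat (i : Fin n) : SmoothMat U (chrMat G i) :=
  (hG.smooth_inv.mul (hG.smooth_lowChrMat i)).congr fun z _ => chrMat_eq i z

lemma smooth_curvMat (i j : Fin n) : SmoothMat U (curvMat G i j) :=
  ((((hG.smooth_chrMat j).dMat hG.isOpen i).sub ((hG.smooth_chrMat i).dMat hG.isOpen j)).add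
    (((hG.smooth_chrMat i).mul (hG.smooth_chrMat j)).sub
      ((hG.smooth_chrMat j).mul (hG.smooth_chrMat i)))).congr fun z _ => curvMat_eq i j z

lemma smooth_covEnd {X : EuclideanSpace ℝ (Fin n) → Matrix (Fin n) (Fin n) ℝ}
    (hX : SmoothMat U X) (m : Fin n) : SmoothMat U (covEnd G m X) :=
  ((hX.dMat hG.isOpen m).add ((hG.smooth_chrMat m).mul hX)).sub (hX.mul (hG.smooth_chrMat m))

lemma chrMat_symm (hy : y ∈ U) (i l m : Fin n) : chrMat G i y l m = chrMat G m y l i := by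
  simp only [chrMat, christoffel, Matrix.of_apply]
  congr 1
  refine Finset.sum_congr rfl fun k _ => ?_
  rw [hG.partialDeriv_symm hy k i m]
  ring

lemma mul_chrMat (hy : y ∈ U) (i : Fin n) : G y * chrMat G i y = lowChrMat G i y := by
  rw [chrMat_eq, ← mul_assoc, Matrix.mul_nonsing_inv _ (hG.isUnit_det hy), one_mul]

lemma transpose_chrMat_mul (hy : y ∈ U) (i : Fin n) :
    (chrMat G i y).transpose * G y = (lowChrMat G i y).transpose := by
  rw [← hG.mul_chrMat hy, Matrix.transpose_mul, (hG.symm y hy).eq]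

/-- Metric compatibility ∇g = 0: in the lowered symbol plus its transpose, the two terms not
differentiated in direction `k` cancel. -/
lemma dMat_metric (hy : y ∈ U) (k : Fin n) :
    dMat k G y = (chrMat G k y).transpose * G y + G y * chrMat G k y := by
  rw [hG.transpose_chrMat_mul hy, hG.mul_chrMat hy]
  ext l j
  simp only [dMat, lowChrMat, Matrix.of_apply, Matrix.add_apply, Matrix.transpose_apply]
  rw [hG.partialDeriv_symm hy k j l]
  ring

/-- A symmetric connection compatible with the metric is the Levi-Civita connection. -/
lemma chrMat_unique (hy : y ∈ U) {C : Fin n → Matrix (Fin n) (Fin n) ℝ}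
    (hsymm : ∀ i l m, C i l m = C m l i)
    (hcomp : ∀ k, dMat k G y = (C k).transpose * G y + G y * C k) (i : Fin n) :
    chrMat G i y = C i := by
  have hl : lowChrMat G i y = G y * C i := by
    have hP : ∀ k a b, partialDeriv k (fun z => G z a b) y
        = (G y * C k) b a + (G y * C k) a b := by
      intro k a b
      have := congrFun (congrFun (hcomp k) a) b
      rw [Matrix.add_apply] at this
      have ht : (C k).transpose * G y = (G y * C k).transpose := by
        rw [Matrix.transpose_mul, (hG.symm y hy).eq]
      rw [ht, Matrix.transpose_apply] at this
      exact this
    have hS : ∀ a b c, (G y * C a) b c = (G y * C c) b a := by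
      intro a b c
      simp only [Matrix.mul_apply]
      exact Finset.sum_congr rfl fun p _ => by rw [hsymm]
    ext l m
    simp only [lowChrMat, Matrix.of_apply, hP]
    rw [hS l m i, hS m i l, hS m l i, hS l i m]
    ring
  rw [chrMat_eq, hl, ← mul_assoc, Matrix.nonsing_inv_mul _ (hG.isUnit_det hy), one_mul]

lemma dMat_curvMat (hy : y ∈ U) (m i j : Fin n) :
    dMat m (curvMat G i j) y = dMat m (dMat i (chrMat G j)) y - dMat m (dMat j (chrMat G i)) y
      + ((dMat m (chrMat G i) y * chrMat G j y + chrMat G i y * dMat m (chrMat G j) y)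
        - (dMat m (chrMat G j) y * chrMat G i y + chrMat G j y * dMat m (chrMat G i) y)) := by
  have hi := hG.smooth_chrMat i
  have hj := hG.smooth_chrMat j
  rw [dMat_congr hG.isOpen (fun z _ => curvMat_eq i j z) hy,
    dMat_add hG.isOpen ((hj.dMat hG.isOpen i).sub (hi.dMat hG.isOpen j))
      ((hi.mul hj).sub (hj.mul hi)) hy,
    dMat_sub hG.isOpen (hj.dMat hG.isOpen i) (hi.dMat hG.isOpen j) hy,
    dMat_sub hG.isOpen (hi.mul hj) (hj.mul hi) hy, dMat_mul hG.isOpen hi hj hy,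
    dMat_mul hG.isOpen hj hi hy]

/-- Skew-adjointness of R(∂_i, ∂_j). Differentiating ∇g = 0 once more expresses ∂_i∂_j G through the
connection; symmetry of the mixed partials leaves exactly the curvature terms. -/
lemma transpose_curvMat_mul (hy : y ∈ U) (i j : Fin n) :
    (curvMat G i j y).transpose * G y = -(G y * curvMat G i j y) := by
  have hdd : ∀ a b, dMat a (dMat b G) y
      = (dMat a (chrMat G b) y).transpose * G y
        + (chrMat G b y).transpose * ((chrMat G a y).transpose * G y + G y * chrMat G a y)
        + (((chrMat G a y).transpose * G y + G y * chrMat G a y) * chrMat G b y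
        + G y * dMat a (chrMat G b) y) := by
    intro a b
    have hb := hG.smooth_chrMat b
    rw [dMat_congr hG.isOpen (fun z hz => hG.dMat_metric hz b) hy,
      dMat_add hG.isOpen (hb.transpose.mul hG.smooth) (hG.smooth.mul hb) hy,
      dMat_mul hG.isOpen hb.transpose hG.smooth hy, dMat_mul hG.isOpen hG.smooth hb hy,
      hG.dMat_metric hy a, dMat_transpose]
  have h := dMat_comm hG.isOpen hG.smooth hy i j
  rw [hdd, hdd] at h
  rw [eq_neg_iff_add_eq_zero, curvMat_eq]
  simp only [Matrix.transpose_add, Matrix.transpose_sub, Matrix.transpose_mul]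
  rw [← sub_eq_zero] at h
  rw [← h]
  noncomm_ring

/-- Torsion-freeness: the lower indices of ∂Γ and of the right factor in ΓΓ may be exchanged, after
which the cyclic sum cancels in pairs. -/
lemma bianchi_first (hy : y ∈ U) (i j k l : Fin n) :
    curvMat G i j y l k + curvMat G j k y l i + curvMat G k i y l j = 0 := by
  have hd : ∀ a b c, dMat a (chrMat G b) y l c = dMat a (chrMat G c) y l b := fun a b c =>
    partialDeriv_congr hG.isOpen (fun z hz => hG.chrMat_symm hz b l c) hy a
  have hm : ∀ a b c, (chrMat G a y * chrMat G b y) l c = (chrMat G a y * chrMat G c y) l b := by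
    intro a b c
    simp only [Matrix.mul_apply]
    exact Finset.sum_congr rfl fun p _ => by rw [hG.chrMat_symm hy b p c]
  simp only [curvMat_eq, Matrix.add_apply, Matrix.sub_apply]
  rw [hd i j k, hd j k i, hd k i j, hm i j k, hm j k i, hm k i j]
  ring

lemma curvature_swap_right (hy : y ∈ U) (i j k l : Fin n) :
    curvature G i j k l y = -curvature G i j l k y := by
  rw [curvature_eq, curvature_eq, ← Matrix.neg_apply, ← hG.transpose_curvMat_mul hy,
    ← Matrix.transpose_apply (_ * _) l k, Matrix.transpose_mul,
    (hG.symm y hy).eq]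

lemma curvature_bianchi (hy : y ∈ U) (i j k l : Fin n) :
    curvature G i j l k y + curvature G j k l i y + curvature G k i l j y = 0 := by
  simp only [curvature_eq, Matrix.mul_apply, ← Finset.sum_add_distrib, ← mul_add,
    hG.bianchi_first hy, mul_zero, Finset.sum_const_zero]

/-- The usual octahedron argument: a combination of four cyclic identities, reduced by the two
antisymmetries. -/
lemma curvature_pair (hy : y ∈ U) (i j k l : Fin n) :
    curvature G i j k l y = curvature G k l i j y := by
  have b := hG.curvature_bianchi hy
  have r := hG.curvature_swap_right hy
  have s := curvature_swap_left (G := G) (y := y)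
  linarith [b i j k l, b j k l i, b k l i j, b l i j k, r i j k l, r j k i l, r k i j l,
    r j k l i, r k l i j, r l j k i, r k l j i, r l i k j, r i k l j, r l i j k, r i j l k,
    r j l i k, s i k j l, s i k l j, s j l i k, s j l k i, s l j k i, s l i j k, s j k i l,
    s k i j l, s k i l j, s l j i k, s i j k l, s k l i j]

end IsMetricOn

end LocalGeometry

/-! ### Ricci identity, second Bianchi identity and their contractions. -/

section LocalGeometry

variable {n : ℕ} {U : Set (EuclideanSpace ℝ (Fin n))} {y : EuclideanSpace ℝ (Fin n)}
  {G : EuclideanSpace ℝ (Fin n) → Matrix (Fin n) (Fin n) ℝ}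

lemma sum_comm_pairs {ι : Type*} [Fintype ι] (f : ι → ι → ι → ι → ℝ) :
    ∑ j, ∑ l, ∑ m, ∑ i, f j l m i = ∑ m, ∑ i, ∑ j, ∑ l, f j l m i := by
  simp only [fun j l => (Fintype.sum_prod_type' (f := f j l)).symm]
  rw [← Fintype.sum_prod_type' (f := fun j l => ∑ x : ι × ι, f j l x.1 x.2), Finset.sum_comm,
    Fintype.sum_prod_type]
  simp only [Fintype.sum_prod_type]

namespace IsMetricOn

variable (hG : IsMetricOn U G)
include hG

/-- The Ricci identity for fields of endomorphisms. -/
lemma covEnd_comm {X : EuclideanSpace ℝ (Fin n) → Matrix (Fin n) (Fin n) ℝ}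
    (hX : SmoothMat U X) (hy : y ∈ U) (l m : Fin n) :
    covEnd G l (covEnd G m X) y - covEnd G m (covEnd G l X) y
      = curvMat G l m y * X y - X y * curvMat G l m y := by
  have hd : ∀ a b, dMat a (covEnd G b X) y = dMat a (dMat b X) y
      + (dMat a (chrMat G b) y * X y + chrMat G b y * dMat a X y)
      - (dMat a X y * chrMat G b y + X y * dMat a (chrMat G b) y) := by
    intro a b
    have hb := hG.smooth_chrMat b
    unfold covEnd
    rw [dMat_sub hG.isOpen ((hX.dMat hG.isOpen b).add (hb.mul hX)) (hX.mul hb) hy,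
      dMat_add hG.isOpen (hX.dMat hG.isOpen b) (hb.mul hX) hy, dMat_mul hG.isOpen hb hX hy,
      dMat_mul hG.isOpen hX hb hy]
  have he : ∀ a b, covEnd G a (covEnd G b X) y = dMat a (covEnd G b X) y
      + chrMat G a y * covEnd G b X y - covEnd G b X y * chrMat G a y := fun _ _ => rfl
  rw [he, he, hd, hd, dMat_comm hG.isOpen hX hy l m, curvMat_eq]
  simp only [covEnd]
  noncomm_ring

/-- The identity d_∇F = 0 for F = dΓ + Γ ∧ Γ, in which the form indices are mere labels: second
derivatives cancel by commutation and the cubic terms by the Jacobi identity. -/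
lemma bianchi_second_covEnd (hy : y ∈ U) (m i j : Fin n) :
    covEnd G m (curvMat G i j) y + covEnd G i (curvMat G j m) y
      + covEnd G j (curvMat G m i) y = 0 := by
  simp only [covEnd, hG.dMat_curvMat hy]
  rw [dMat_comm hG.isOpen (hG.smooth_chrMat j) hy m i,
    dMat_comm hG.isOpen (hG.smooth_chrMat m) hy i j,
    dMat_comm hG.isOpen (hG.smooth_chrMat i) hy j m]
  simp only [curvMat_eq]
  noncomm_ring

/-- The Christoffel corrections for the form indices cancel in pairs over the cyclic sum because the
connection is torsion-free. -/
lemma bianchi_second (hy : y ∈ U) (m i j : Fin n) :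
    covCurv G m i j y + covCurv G i j m y + covCurv G j m i y = 0 := by
  have h := hG.bianchi_second_covEnd hy m i j
  have hs : ∀ a b c, ∑ p, chrMat G a y p b • curvMat G p c y
      = -∑ p, chrMat G b y p a • curvMat G c p y := by
    intro a b c
    rw [← Finset.sum_neg_distrib]
    exact Finset.sum_congr rfl fun p _ => by
      rw [hG.chrMat_symm hy a p b, curvMat_swap p c, smul_neg]
  simp only [covCurv]
  rw [hs m i j, hs i j m, hs j m i, ← h]
  abel

/-- Since ∇g = 0, lowering an index commutes with covariant differentiation. This moves the
coordinate definition into the matrix calculus. -/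
lemma nablaCurvature_eq (hy : y ∈ U) (m i j k l : Fin n) :
    nablaCurvature G m i j k l y = (G y * covCurv G m i j y) k l := by
  have hd : partialDeriv m (curvature G i j k l) y
      = (dMat m G y * curvMat G i j y + G y * dMat m (curvMat G i j) y) k l := by
    rw [← dMat_mul hG.isOpen hG.smooth (hG.smooth_curvMat i j) hy]
    exact partialDeriv_congr hG.isOpen (fun z _ => curvature_eq i j k l z) hy m
  have h1 : ∑ p, christoffel G m i p y * curvature G p j k l y
      = (G y * ∑ p, chrMat G m y p i • curvMat G p j y) k l := by
    rw [Finset.mul_sum, Matrix.sum_apply]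
    exact Finset.sum_congr rfl fun p _ => by
      rw [curvature_eq, mul_smul_comm, Matrix.smul_apply, smul_eq_mul]; rfl
  have h2 : ∑ p, christoffel G m j p y * curvature G i p k l y
      = (G y * ∑ p, chrMat G m y p j • curvMat G i p y) k l := by
    rw [Finset.mul_sum, Matrix.sum_apply]
    exact Finset.sum_congr rfl fun p _ => by
      rw [curvature_eq, mul_smul_comm, Matrix.smul_apply, smul_eq_mul]; rfl
  have h3 : ∑ p, christoffel G m k p y * curvature G i j p l y
      = ((chrMat G m y).transpose * (G y * curvMat G i j y)) k l := by
    rw [Matrix.mul_apply]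
    exact Finset.sum_congr rfl fun p _ => by rw [curvature_eq]; rfl
  have h4 : ∑ p, christoffel G m l p y * curvature G i j k p y
      = ((G y * curvMat G i j y) * chrMat G m y) k l := by
    rw [Matrix.mul_apply]
    exact Finset.sum_congr rfl fun p _ => by rw [curvature_eq, mul_comm]; rfl
  rw [nablaCurvature]
  simp only [Finset.sum_add_distrib]
  rw [hd, h1, h2, h3, h4, hG.dMat_metric hy, covCurv, covEnd]
  simp only [← Matrix.add_apply, ← Matrix.sub_apply]
  refine congrFun (congrFun (?_ : (_ : Matrix (Fin n) (Fin n) ℝ) = _) k) l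
  noncomm_ring

lemma nablaCurvature_pair (hy : y ∈ U) (m i j k l : Fin n) :
    nablaCurvature G m i j k l y = nablaCurvature G m k l i j y := by
  have hd := partialDeriv_congr hG.isOpen (fun z hz => hG.curvature_pair hz i j k l) hy m
  have hd' : partialDeriv m (curvature G i j k l) y = partialDeriv m (curvature G k l i j) y := hd
  rw [nablaCurvature, nablaCurvature, hd']
  congr 1
  refine Finset.sum_congr rfl fun p _ => ?_
  rw [hG.curvature_pair hy p j k l, hG.curvature_pair hy i p k l, hG.curvature_pair hy i j p l,
    hG.curvature_pair hy i j k p]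
  ring

lemma curvature_swap_both (hy : y ∈ U) (i j k l : Fin n) :
    curvature G i j k l y = curvature G j i l k y := by
  rw [curvature_swap_left, hG.curvature_swap_right hy j i, neg_neg]

lemma nablaCurvature_swap_both (hy : y ∈ U) (m i j k l : Fin n) :
    nablaCurvature G m i j k l y = nablaCurvature G m j i l k y := by
  have hd := partialDeriv_congr hG.isOpen (fun z hz => hG.curvature_swap_both hz i j k l) hy m
  have hd' : partialDeriv m (curvature G i j k l) y = partialDeriv m (curvature G j i l k) y := hd
  rw [nablaCurvature, nablaCurvature, hd']
  congr 1
  refine Finset.sum_congr rfl fun p _ => ?_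
  rw [hG.curvature_swap_both hy p j k l, hG.curvature_swap_both hy i p k l,
    hG.curvature_swap_both hy i j p l, hG.curvature_swap_both hy i j k p]
  ring

omit hG in
lemma sum_inv_mul (hdet : IsUnit (G y).det) (Z : Fin n → Matrix (Fin n) (Fin n) ℝ) (k : Fin n) :
    ∑ j, ∑ l, (G y)⁻¹ j l * (G y * Z j) l k = ∑ j, Z j j k := by
  refine Finset.sum_congr rfl fun j _ => ?_
  rw [← Matrix.mul_apply, ← mul_assoc, Matrix.nonsing_inv_mul _ hdet, one_mul]

lemma ricMat_apply (hy : y ∈ U) (i k : Fin n) :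
    ricMat G y i k = ∑ j, curvMat G j i y j k := by
  rw [← sum_inv_mul (hG.isUnit_det hy) (fun j => curvMat G j i y) k]
  simp only [ricMat, ricci, Matrix.of_apply]
  refine Finset.sum_congr rfl fun j _ => Finset.sum_congr rfl fun l _ => ?_
  rw [hG.curvature_swap_both hy, curvature_eq]

lemma inv_symm (hy : y ∈ U) : ((G y)⁻¹).IsSymm := by
  rw [Matrix.IsSymm, Matrix.transpose_nonsing_inv, (hG.symm y hy).eq]

lemma ricMat_symm (hy : y ∈ U) : (ricMat G y).IsSymm := by
  ext i k
  simp only [Matrix.transpose_apply, ricMat, ricci, Matrix.of_apply]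
  rw [Finset.sum_comm]
  refine Finset.sum_congr rfl fun j _ => Finset.sum_congr rfl fun l _ => ?_
  rw [hG.curvature_pair hy, (hG.inv_symm hy).apply]

lemma smooth_ricMat : SmoothMat U (ricMat G) := fun i k =>
  (ContDiffOn.sum fun j _ => hG.smooth_curvMat j i j k).congr fun _ hz => hG.ricMat_apply hz i k

/-- Contraction commutes with ∇: the correction for the contracted upper index cancels the one for
the contracted lower index (`h3`). -/
lemma covForm_ricMat (hy : y ∈ U) (m i k : Fin n) :
    covForm G m (ricMat G) y i k = ∑ j, covCurv G m j i y j k := by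
  have hd : dMat m (ricMat G) y i k = ∑ j, dMat m (curvMat G j i) y j k := by
    rw [dMat, Matrix.of_apply,
      partialDeriv_congr hG.isOpen (fun z hz => hG.ricMat_apply hz i k) hy,
      partialDeriv_sum hG.isOpen (fun j => hG.smooth_curvMat j i j k) hy]
    rfl
  have h1 : ((chrMat G m y).transpose * ricMat G y) i k
      = ∑ j, (∑ p, chrMat G m y p i • curvMat G j p y) j k := by
    simp only [Matrix.mul_apply, Matrix.transpose_apply, hG.ricMat_apply hy, Matrix.sum_apply,
      Matrix.smul_apply, smul_eq_mul, Finset.mul_sum]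
    rw [Finset.sum_comm]
  have h2 : (ricMat G y * chrMat G m y) i k = ∑ j, (curvMat G j i y * chrMat G m y) j k := by
    simp only [Matrix.mul_apply, hG.ricMat_apply hy, Finset.sum_mul]
    rw [Finset.sum_comm]
  have h3 : ∑ j, (chrMat G m y * curvMat G j i y) j k
      = ∑ j, (∑ p, chrMat G m y p j • curvMat G p i y) j k := by
    simp only [Matrix.mul_apply, Matrix.sum_apply, Matrix.smul_apply, smul_eq_mul]
    rw [Finset.sum_comm]
  simp only [covForm, covCurv, covEnd, Matrix.sub_apply, Matrix.add_apply,
    Finset.sum_sub_distrib, Finset.sum_add_distrib]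
  rw [hd, h1, h2, h3]
  ring

/-- Pair symmetry moves the divergence index into the endomorphism slot; tracing the second Bianchi
identity there turns its other two terms into derivatives of Ric. Vanishing divergence is thus the
Codazzi equation for Ric. -/
lemma divCurvature_eq (hy : y ∈ U) (j k l : Fin n) :
    divCurvature G j k l y
      = covForm G k (ricMat G) y l j - covForm G l (ricMat G) y k j := by
  have h : divCurvature G j k l y = ∑ m, covCurv G m k l y m j := by
    rw [← sum_inv_mul (hG.isUnit_det hy) (fun m => covCurv G m k l y) j, divCurvature]
    refine Finset.sum_congr rfl fun m _ => Finset.sum_congr rfl fun i _ => ?_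
    rw [hG.nablaCurvature_pair hy, hG.nablaCurvature_eq hy]
  have hswap : ∀ a b c, covCurv G a b c y = -covCurv G a c b y := by
    intro a b c
    have hcurv : covEnd G a (curvMat G b c) y = -covEnd G a (curvMat G c b) y := by
      have : dMat a (curvMat G b c) y = -dMat a (curvMat G c b) y := by
        have h0 := dMat_sub hG.isOpen (SmoothMat.const 0) (hG.smooth_curvMat c b) hy a
        rw [dMat_const, zero_sub] at h0
        rw [← h0]
        exact dMat_congr hG.isOpen (fun z _ => by rw [curvMat_swap, zero_sub]) hy a
      rw [covEnd, covEnd, this, curvMat_swap b c]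
      noncomm_ring
    have hs : ∀ d e, ∑ p, chrMat G a y p d • curvMat G p e y
        = -∑ p, chrMat G a y p d • curvMat G e p y := by
      intro d e
      rw [← Finset.sum_neg_distrib]
      exact Finset.sum_congr rfl fun p _ => by rw [curvMat_swap p e, smul_neg]
    rw [covCurv, covCurv, hcurv, hs b c, hs c b]
    abel
  rw [h, hG.covForm_ricMat hy, hG.covForm_ricMat hy, ← Finset.sum_sub_distrib]
  refine Finset.sum_congr rfl fun m _ => ?_
  have hb := congrFun (congrFun (hG.bianchi_second hy m k l) m) j
  rw [hswap k l m] at hb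
  simp only [Matrix.add_apply, Matrix.neg_apply, Matrix.zero_apply] at hb
  linarith

/-- The remaining trace of div R is div Ric. Combined with the Codazzi equation this controls the
differential of the scalar curvature. -/
lemma sum_inv_divCurvature (hy : y ∈ U) (k : Fin n) :
    ∑ j, ∑ l, (G y)⁻¹ j l * divCurvature G j k l y
      = ∑ m, ∑ i, (G y)⁻¹ m i * covForm G m (ricMat G) y i k := by
  have hc : ∀ m i, covForm G m (ricMat G) y i k
      = ∑ j, ∑ l, (G y)⁻¹ j l * nablaCurvature G m i j k l y := by
    intro m i
    rw [hG.covForm_ricMat hy, ← sum_inv_mul (hG.isUnit_det hy) (fun j => covCurv G m j i y) k]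
    refine Finset.sum_congr rfl fun j _ => Finset.sum_congr rfl fun l _ => ?_
    rw [hG.nablaCurvature_swap_both hy, hG.nablaCurvature_eq hy]
  simp only [hc, divCurvature, Finset.mul_sum]
  rw [sum_comm_pairs]
  refine Finset.sum_congr rfl fun m _ => Finset.sum_congr rfl fun i _ =>
    Finset.sum_congr rfl fun j _ => Finset.sum_congr rfl fun l _ => by ring

/-- Differentiating G⁻¹G = 1 turns ∇g = 0 into ∇g⁻¹ = 0, so raising an index also commutes with ∇.
-/
lemma dMat_inv (hy : y ∈ U) (m : Fin n) :
    dMat m (fun z => (G z)⁻¹) y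
      = -(chrMat G m y * (G y)⁻¹ + (G y)⁻¹ * (chrMat G m y).transpose) := by
  have hu := hG.isUnit_det hy
  have h := dMat_mul hG.isOpen hG.smooth_inv hG.smooth hy m
  rw [dMat_congr hG.isOpen (Y := fun _ => 1)
    (fun z hz => Matrix.nonsing_inv_mul _ (hG.isUnit_det hz)) hy, dMat_const,
    hG.dMat_metric hy] at h
  have h' : dMat m (fun z => (G z)⁻¹) y * G y
      = -((G y)⁻¹ * ((chrMat G m y).transpose * G y + G y * chrMat G m y)) :=
    eq_neg_of_add_eq_zero_left h.symm
  calc dMat m (fun z => (G z)⁻¹) y = dMat m (fun z => (G z)⁻¹) y * G y * (G y)⁻¹ := by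
        rw [mul_assoc, Matrix.mul_nonsing_inv _ hu, mul_one]
    _ = -((G y)⁻¹ * (chrMat G m y).transpose * (G y * (G y)⁻¹)
          + ((G y)⁻¹ * G y) * chrMat G m y * (G y)⁻¹) := by
        rw [h']; noncomm_ring
    _ = _ := by
        rw [Matrix.mul_nonsing_inv _ hu, Matrix.nonsing_inv_mul _ hu]; noncomm_ring

lemma covEnd_inv_mul {h : EuclideanSpace ℝ (Fin n) → Matrix (Fin n) (Fin n) ℝ}
    (hh : SmoothMat U h) (hy : y ∈ U) (m : Fin n) :
    covEnd G m (fun z => (G z)⁻¹ * h z) y = (G y)⁻¹ * covForm G m h y := by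
  rw [covEnd, dMat_mul hG.isOpen hG.smooth_inv hh hy, hG.dMat_inv hy, covForm]
  noncomm_ring

/-- Covariant differentiation preserves self-adjointness. -/
lemma isSymm_mul_covEnd {X : EuclideanSpace ℝ (Fin n) → Matrix (Fin n) (Fin n) ℝ}
    (hX : SmoothMat U X) (hs : ∀ z ∈ U, (G z * X z).IsSymm) (hy : y ∈ U) (m : Fin n) :
    (G y * covEnd G m X y).IsSymm := by
  have hd : (dMat m (fun z => G z * X z) y).IsSymm := by
    rw [Matrix.IsSymm, ← dMat_transpose]
    exact dMat_congr hG.isOpen (fun z hz => hs z hz) hy m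
  have he : G y * covEnd G m X y = dMat m (fun z => G z * X z) y
      - ((chrMat G m y).transpose * (G y * X y) + (G y * X y) * chrMat G m y) := by
    rw [dMat_mul hG.isOpen hG.smooth hX hy, hG.dMat_metric hy, covEnd]
    noncomm_ring
  rw [he]
  refine hd.sub ?_
  rw [Matrix.IsSymm, Matrix.transpose_add, Matrix.transpose_mul, Matrix.transpose_mul (_ * _),
    (hs y hy).eq, Matrix.transpose_transpose, add_comm]

end IsMetricOn

end LocalGeometry

/-! ### Harmonic curvature and the Bochner formula for the Ricci tensor -/

section Bochner

variable {n : ℕ} {U : Set (EuclideanSpace ℝ (Fin n))} {y : EuclideanSpace ℝ (Fin n)}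
  {G : EuclideanSpace ℝ (Fin n) → Matrix (Fin n) (Fin n) ℝ}

variable (G) in
/-- The Ricci endomorphism. -/
def ricEnd (y : EuclideanSpace ℝ (Fin n)) : Matrix (Fin n) (Fin n) ℝ :=
  (G y)⁻¹ * ricMat G y

variable (G) in
/-- The scalar curvature. -/
def scalCurv (y : EuclideanSpace ℝ (Fin n)) : ℝ := (ricEnd G y).trace

variable (G) in
/-- The squared norm of the Ricci tensor. -/
def ricNormSq (y : EuclideanSpace ℝ (Fin n)) : ℝ := (ricEnd G y * ricEnd G y).trace

namespace IsMetricOn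

variable (hG : IsMetricOn U G)
include hG

lemma smooth_ricEnd : SmoothMat U (ricEnd G) := hG.smooth_inv.mul hG.smooth_ricMat

lemma mul_ricEnd (hy : y ∈ U) : G y * ricEnd G y = ricMat G y := by
  rw [ricEnd, ← mul_assoc, Matrix.mul_nonsing_inv _ (hG.isUnit_det hy), one_mul]

lemma isSymm_mul_ricEnd (hy : y ∈ U) : (G y * ricEnd G y).IsSymm := by
  rw [hG.mul_ricEnd hy]
  exact hG.ricMat_symm hy

lemma covEnd_ricEnd (hy : y ∈ U) (m : Fin n) :
    covEnd G m (ricEnd G) y = (G y)⁻¹ * covForm G m (ricMat G) y :=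
  hG.covEnd_inv_mul hG.smooth_ricMat hy m

lemma covForm_ricMat_symm (hy : y ∈ U) (m : Fin n) : (covForm G m (ricMat G) y).IsSymm := by
  have h := hG.isSymm_mul_covEnd hG.smooth_ricEnd (fun z hz => hG.isSymm_mul_ricEnd hz) hy m
  rwa [hG.covEnd_ricEnd hy, ← mul_assoc, Matrix.mul_nonsing_inv _ (hG.isUnit_det hy),
    one_mul] at h

/-- The connection enters `covEnd` through a commutator, which has trace zero. -/
lemma partialDeriv_trace_eq {X : EuclideanSpace ℝ (Fin n) → Matrix (Fin n) (Fin n) ℝ}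
    (hX : SmoothMat U X) (hy : y ∈ U) (m : Fin n) :
    partialDeriv m (fun z => (X z).trace) y = (covEnd G m X y).trace := by
  rw [partialDeriv_trace hG.isOpen hX hy, covEnd, Matrix.trace_sub, Matrix.trace_add,
    Matrix.trace_mul_comm (chrMat G m y), add_sub_cancel_right]

lemma covEnd_mul {X Y : EuclideanSpace ℝ (Fin n) → Matrix (Fin n) (Fin n) ℝ}
    (hX : SmoothMat U X) (hY : SmoothMat U Y) (hy : y ∈ U) (m : Fin n) :
    covEnd G m (fun z => X z * Y z) y = covEnd G m X y * Y y + X y * covEnd G m Y y := by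
  simp only [covEnd]
  rw [dMat_mul hG.isOpen hX hY hy]
  noncomm_ring

lemma smooth_ricNormSq : ContDiffOn ℝ ∞ (ricNormSq G) U :=
  (hG.smooth_ricEnd.mul hG.smooth_ricEnd).trace

lemma smooth_scalCurv : ContDiffOn ℝ ∞ (scalCurv G) U := hG.smooth_ricEnd.trace

lemma partialDeriv_ricNormSq (hy : y ∈ U) (m : Fin n) :
    partialDeriv m (ricNormSq G) y = 2 * (ricEnd G y * covEnd G m (ricEnd G) y).trace := by
  have h := hG.partialDeriv_trace_eq (hG.smooth_ricEnd.mul hG.smooth_ricEnd) hy m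
  rw [hG.covEnd_mul hG.smooth_ricEnd hG.smooth_ricEnd hy, Matrix.trace_add,
    Matrix.trace_mul_comm] at h
  rw [two_mul]
  exact h

lemma partialDeriv_partialDeriv_ricNormSq (hy : y ∈ U) (m : Fin n) :
    partialDeriv m (partialDeriv m (ricNormSq G)) y
      = 2 * ((covEnd G m (ricEnd G) y * covEnd G m (ricEnd G) y).trace
        + (ricEnd G y * covEnd G m (covEnd G m (ricEnd G)) y).trace) := by
  have hT := hG.smooth_covEnd hG.smooth_ricEnd m
  rw [partialDeriv_congr hG.isOpen (fun z hz => hG.partialDeriv_ricNormSq hz m) hy,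
    partialDeriv_mul hG.isOpen contDiffOn_const (hG.smooth_ricEnd.mul hT).trace hy,
    hG.partialDeriv_trace_eq (hG.smooth_ricEnd.mul hT) hy,
    hG.covEnd_mul hG.smooth_ricEnd hT hy, Matrix.trace_add]
  simp [partialDeriv]

/-! ### Divergence-free curvature: Codazzi equation, constant scalar curvature, Laplacian of Ric. -/

section Harmonic

variable (hdiv : ∀ z ∈ U, ∀ j k l, divCurvature G j k l z = 0)
include hdiv

lemma codazzi (hy : y ∈ U) (m i j : Fin n) :
    covEnd G m (ricEnd G) y i j = covEnd G j (ricEnd G) y i m := by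
  rw [hG.covEnd_ricEnd hy, hG.covEnd_ricEnd hy, Matrix.mul_apply, Matrix.mul_apply]
  refine Finset.sum_congr rfl fun p _ => ?_
  have h := hdiv y hy p m j
  rw [hG.divCurvature_eq hy, sub_eq_zero] at h
  rw [(hG.covForm_ricMat_symm hy m).apply, h, (hG.covForm_ricMat_symm hy j).apply]

/-- By the Codazzi equation the trace of ∇_k Ric is the divergence of Ric, which is a trace of div R
and hence zero. -/
lemma trace_covEnd_ricEnd (hy : y ∈ U) (k : Fin n) : (covEnd G k (ricEnd G) y).trace = 0 := by
  have h := hG.sum_inv_divCurvature hy k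
  simp only [hdiv y hy, mul_zero, Finset.sum_const_zero] at h
  rw [h, Matrix.trace]
  refine Finset.sum_congr rfl fun m _ => ?_
  rw [Matrix.diag_apply, hG.codazzi hdiv hy, hG.covEnd_ricEnd hy, Matrix.mul_apply]

lemma partialDeriv_scalCurv (hy : y ∈ U) (k : Fin n) : partialDeriv k (scalCurv G) y = 0 :=
  (hG.partialDeriv_trace_eq hG.smooth_ricEnd hy k).trans (hG.trace_covEnd_ricEnd hdiv hy k)

/-- The covariant derivative of the Codazzi equation. `covEnd` treats its direction `m` as a label,
so the subtracted sums supply the missing correction that makes the second derivative a tensor. -/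
lemma covEnd_covEnd_codazzi (hy : y ∈ U) (l m i j : Fin n) :
    covEnd G l (covEnd G m (ricEnd G)) y i j - ∑ p, chrMat G l y p m * covEnd G p (ricEnd G) y i j
      = covEnd G l (covEnd G j (ricEnd G)) y i m
        - ∑ p, chrMat G l y p j * covEnd G p (ricEnd G) y i m := by
  have hd : dMat l (covEnd G m (ricEnd G)) y i j = dMat l (covEnd G j (ricEnd G)) y i m :=
    partialDeriv_congr hG.isOpen (fun z hz => hG.codazzi hdiv hz m i j) hy l
  have he : ∀ b, covEnd G l (covEnd G b (ricEnd G)) y = dMat l (covEnd G b (ricEnd G)) y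
      + chrMat G l y * covEnd G b (ricEnd G) y - covEnd G b (ricEnd G) y * chrMat G l y :=
    fun _ => rfl
  have h1 : (chrMat G l y * covEnd G m (ricEnd G) y) i j
      = (chrMat G l y * covEnd G j (ricEnd G) y) i m := by
    simp only [Matrix.mul_apply]
    exact Finset.sum_congr rfl fun p _ => by rw [hG.codazzi hdiv hy m]
  have h2 : ∀ a b, (covEnd G a (ricEnd G) y * chrMat G l y) i b
      = ∑ p, chrMat G l y p b * covEnd G p (ricEnd G) y i a := by
    intro a b
    rw [Matrix.mul_apply]
    exact Finset.sum_congr rfl fun p _ => by rw [hG.codazzi hdiv hy a, mul_comm]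
  rw [he, he]
  simp only [Matrix.add_apply, Matrix.sub_apply]
  rw [hd, h1, h2, h2]
  ring

lemma trace_covEnd_covEnd (hy : y ∈ U) (l m : Fin n) :
    (covEnd G l (covEnd G m (ricEnd G)) y).trace = 0 := by
  rw [← hG.partialDeriv_trace_eq (hG.smooth_covEnd hG.smooth_ricEnd m) hy,
    partialDeriv_congr hG.isOpen (fun z hz => hG.trace_covEnd_ricEnd hdiv hz m) hy]
  simp [partialDeriv]

/-- The rough Laplacian of the Ricci tensor at a point where the coordinates are orthonormal. -/
lemma laplacian_ricEnd (hy : y ∈ U) (h1 : G y = 1) (i j : Fin n) :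
    ∑ l, (covEnd G l (covEnd G l (ricEnd G)) y i j
        - ∑ p, chrMat G l y p l * covEnd G p (ricEnd G) y i j)
      = ∑ l, (curvMat G l j y * ricEnd G y - ricEnd G y * curvMat G l j y) i l := by
  have hsymm : ∀ a b, (covEnd G a (covEnd G b (ricEnd G)) y).IsSymm := by
    intro a b
    have h := hG.isSymm_mul_covEnd (hG.smooth_covEnd hG.smooth_ricEnd b)
      (fun z hz => hG.isSymm_mul_covEnd hG.smooth_ricEnd
        (fun w hw => hG.isSymm_mul_ricEnd hw) hz b) hy a
    rwa [h1, one_mul] at h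
  have hsymm1 : ∀ a, (covEnd G a (ricEnd G) y).IsSymm := by
    intro a
    have h := hG.isSymm_mul_covEnd hG.smooth_ricEnd (fun w hw => hG.isSymm_mul_ricEnd hw) hy a
    rwa [h1, one_mul] at h
  -- Total symmetry turns the divergence term ∇_j∇_l H_il into ∇_j∇_i H_ll, whose sum is a second
  -- derivative of the constant trace.
  have hzero : ∑ l, (covEnd G j (covEnd G l (ricEnd G)) y i l
      - ∑ p, chrMat G j y p l * covEnd G p (ricEnd G) y i l) = 0 := by
    have : ∀ l, covEnd G j (covEnd G l (ricEnd G)) y i l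
        - ∑ p, chrMat G j y p l * covEnd G p (ricEnd G) y i l
        = covEnd G j (covEnd G i (ricEnd G)) y l l
          - ∑ p, chrMat G j y p i * covEnd G p (ricEnd G) y l l := by
      intro l
      rw [← hG.covEnd_covEnd_codazzi hdiv hy j l l i, (hsymm j l).apply]
      congr 1
      exact Finset.sum_congr rfl fun p _ => by rw [(hsymm1 p).apply]
    rw [Finset.sum_congr rfl fun l _ => this l, Finset.sum_sub_distrib, Finset.sum_comm]
    have ht := hG.trace_covEnd_covEnd hdiv hy j i
    simp only [Matrix.trace, Matrix.diag] at ht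
    rw [ht, zero_sub, neg_eq_zero]
    refine Finset.sum_eq_zero fun p _ => ?_
    have ht' := hG.trace_covEnd_ricEnd hdiv hy p
    simp only [Matrix.trace, Matrix.diag] at ht'
    rw [← Finset.mul_sum, ht', mul_zero]
  -- With this zero subtracted, Codazzi replaces ∇_l∇_l H_ij by ∇_l∇_j H_il, and the Ricci identity
  -- evaluates its difference from ∇_j∇_l H_il. The corrections in the direction index agree by
  -- torsion-freeness.
  rw [← sub_zero (∑ l, (_ - _)), ← hzero, ← Finset.sum_sub_distrib]
  refine Finset.sum_congr rfl fun l _ => ?_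
  rw [hG.covEnd_covEnd_codazzi hdiv hy l l i j, ← hG.covEnd_comm hG.smooth_ricEnd hy,
    Matrix.sub_apply]
  simp only [fun p => hG.chrMat_symm hy l p j]
  ring

/-- At a maximum point of the norm of the Ricci tensor the curvature term of the Bochner formula
is nonpositive. -/
lemma bochner_nonpos_of_isLocalMax (hy : y ∈ U) (h1 : G y = 1) {ρ : Fin n → ℝ}
    (hρ : ricMat G y = Matrix.diagonal ρ) (hmax : IsLocalMax (ricNormSq G) y) :
    ∑ i, ∑ j, curvature G i j i j y * (ρ i - ρ j) ^ 2 ≤ 0 := by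
  have hH : ricEnd G y = Matrix.diagonal ρ := by rw [← hρ, ← hG.mul_ricEnd hy, h1, one_mul]
  have hcrit : ∀ p, (ricEnd G y * covEnd G p (ricEnd G) y).trace = 0 := by
    intro p
    have h := hG.partialDeriv_ricNormSq hy p
    rw [partialDeriv, hmax.fderiv_eq_zero] at h
    simpa using h.symm
  -- Pure coordinate second derivatives suffice: the metric is the identity at `y`, and the
  -- first-order terms separating their sum from the Laplacian vanish at a critical point (`e3`).
  -- Normal coordinates are not needed.
  have hneg : ∑ m, (ricEnd G y * covEnd G m (covEnd G m (ricEnd G)) y).trace ≤ 0 := by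
    refine Finset.sum_nonpos fun m _ => ?_
    have h := partialDeriv_partialDeriv_nonpos hG.isOpen hG.smooth_ricNormSq hy hmax m
    rw [hG.partialDeriv_partialDeriv_ricNormSq hy] at h
    have hs := hG.isSymm_mul_covEnd hG.smooth_ricEnd (fun w hw => hG.isSymm_mul_ricEnd hw) hy m
    rw [h1, one_mul] at hs
    have hpos : 0 ≤ (covEnd G m (ricEnd G) y * covEnd G m (ricEnd G) y).trace := by
      simp only [Matrix.trace, Matrix.diag, Matrix.mul_apply]
      refine Finset.sum_nonneg fun i _ => Finset.sum_nonneg fun j _ => ?_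
      rw [hs.apply i j]
      exact mul_self_nonneg _
    linarith
  have hlap : ∑ m, (ricEnd G y * covEnd G m (covEnd G m (ricEnd G)) y).trace
      = ∑ j, ∑ l, ρ j * (curvMat G l j y j l * (ρ l - ρ j)) := by
    have e1 : ∀ X : Matrix (Fin n) (Fin n) ℝ, (ricEnd G y * X).trace = ∑ j, ρ j * X j j := by
      intro X
      simp [hH, Matrix.trace, Matrix.diagonal_mul]
    have e2 : ∀ j, ∑ l, (covEnd G l (covEnd G l (ricEnd G)) y j j
        - ∑ p, chrMat G l y p l * covEnd G p (ricEnd G) y j j)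
        = ∑ l, curvMat G l j y j l * (ρ l - ρ j) := by
      intro j
      rw [hG.laplacian_ricEnd hdiv hy h1]
      refine Finset.sum_congr rfl fun l _ => ?_
      rw [hH, Matrix.sub_apply, Matrix.mul_diagonal, Matrix.diagonal_mul]
      ring
    have e3 : ∑ j, ρ j * ∑ l, ∑ p, chrMat G l y p l * covEnd G p (ricEnd G) y j j = 0 := by
      have : ∀ l p, ∑ j, ρ j * (chrMat G l y p l * covEnd G p (ricEnd G) y j j) = 0 := by
        intro l p
        have h := hcrit p
        rw [e1] at h
        rw [← mul_zero (chrMat G l y p l), ← h, Finset.mul_sum]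
        exact Finset.sum_congr rfl fun j _ => by ring
      simp only [Finset.mul_sum]
      rw [Finset.sum_comm]
      refine Finset.sum_eq_zero fun l _ => ?_
      rw [Finset.sum_comm]
      exact Finset.sum_eq_zero fun p _ => this l p
    simp only [e1]
    rw [Finset.sum_comm]
    simp only [← Finset.mul_sum]
    simp only [← e2]
    simp only [Finset.sum_sub_distrib, mul_sub]
    rw [e3, sub_zero]
  have hK : ∀ l j, curvMat G l j y j l = -curvature G l j l j y := by
    intro l j
    rw [hG.curvature_swap_right hy, neg_neg, curvature_eq, h1, one_mul]
  have hsymmK : ∀ l j, curvature G l j l j y = curvature G j l j l y :=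
    fun l j => hG.curvature_swap_both hy l j l j
  -- Symmetrizing in the two indices turns ρ_j(ρ_j - ρ_l) into half the square (ρ_j - ρ_l)².
  have hfin : ∑ i, ∑ j, curvature G i j i j y * (ρ i - ρ j) ^ 2
      = 2 * ∑ j, ∑ l, ρ j * (curvMat G l j y j l * (ρ l - ρ j)) := by
    have hA : ∑ j, ∑ l, ρ j * (curvMat G l j y j l * (ρ l - ρ j))
        = ∑ j, ∑ l, curvature G j l j l y * (ρ j * (ρ j - ρ l)) :=
      Finset.sum_congr rfl fun j _ => Finset.sum_congr rfl fun l _ => by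
        rw [hK, hsymmK]; ring
    have hB : ∑ j, ∑ l, curvature G j l j l y * (ρ j * (ρ j - ρ l))
        = ∑ j, ∑ l, curvature G j l j l y * (ρ l * (ρ l - ρ j)) := by
      rw [Finset.sum_comm]
      exact Finset.sum_congr rfl fun j _ => Finset.sum_congr rfl fun l _ => by rw [hsymmK]
    rw [two_mul, hA]
    nth_rewrite 2 [hB]
    simp only [← Finset.sum_add_distrib]
    exact Finset.sum_congr rfl fun j _ => Finset.sum_congr rfl fun l _ => by ring
  rw [hfin, ← hlap]
  linarith

end Harmonic

end IsMetricOn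

end Bochner

/-! ### Change of coordinates -/

section CoordinateChange

variable {n : ℕ} {U V : Set (EuclideanSpace ℝ (Fin n))} {x : EuclideanSpace ℝ (Fin n)}
  {G G' : EuclideanSpace ℝ (Fin n) → Matrix (Fin n) (Fin n) ℝ}
  {ψ : EuclideanSpace ℝ (Fin n) → EuclideanSpace ℝ (Fin n)}

/-- The Jacobi matrix `J_ai = ∂_i ψ^a`. -/
def jacobiMat (ψ : EuclideanSpace ℝ (Fin n) → EuclideanSpace ℝ (Fin n))
    (x : EuclideanSpace ℝ (Fin n)) : Matrix (Fin n) (Fin n) ℝ :=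
  Matrix.of fun a i => partialDeriv i (fun z => ψ z a) x

lemma contDiffOn_coord (hψ : ContDiffOn ℝ ∞ ψ V) (a : Fin n) :
    ContDiffOn ℝ ∞ (fun z => ψ z a) V :=
  (contDiffOn_euclidean.1 hψ) a

lemma fderiv_single_apply (hV : IsOpen V) (hψ : ContDiffOn ℝ ∞ ψ V) (hx : x ∈ V)
    (i a : Fin n) : fderiv ℝ ψ x (EuclideanSpace.single i 1) a = jacobiMat ψ x a i := by
  have hd : DifferentiableAt ℝ ψ x :=
    (hψ.contDiffAt (hV.mem_nhds hx)).differentiableAt (by simp)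
  have h : HasFDerivAt (fun z => ψ z a) ((EuclideanSpace.proj a).comp (fderiv ℝ ψ x)) x :=
    (EuclideanSpace.proj a : EuclideanSpace ℝ (Fin n) →L[ℝ] ℝ).hasFDerivAt.comp x hd.hasFDerivAt
  simp only [jacobiMat, Matrix.of_apply, partialDeriv]
  rw [h.fderiv]
  rfl

lemma smooth_jacobiMat (hV : IsOpen V) (hψ : ContDiffOn ℝ ∞ ψ V) :
    SmoothMat V (jacobiMat ψ) := fun a i => contDiffOn_partialDeriv hV (contDiffOn_coord hψ a) i

lemma dMat_jacobiMat_symm (hV : IsOpen V) (hψ : ContDiffOn ℝ ∞ ψ V) (hx : x ∈ V)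
    (i a k : Fin n) : dMat i (jacobiMat ψ) x a k = dMat k (jacobiMat ψ) x a i :=
  partialDeriv_comm hV (contDiffOn_coord hψ a) hx i k

lemma partialDeriv_comp (hU : IsOpen U) (hV : IsOpen V) (hψ : ContDiffOn ℝ ∞ ψ V)
    (hmaps : Set.MapsTo ψ V U) {f : EuclideanSpace ℝ (Fin n) → ℝ} (hf : ContDiffOn ℝ ∞ f U)
    (hx : x ∈ V) (i : Fin n) :
    partialDeriv i (fun z => f (ψ z)) x
      = ∑ a, jacobiMat ψ x a i * partialDeriv a f (ψ x) := by
  have hd : DifferentiableAt ℝ ψ x :=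
    (hψ.contDiffAt (hV.mem_nhds hx)).differentiableAt (by simp)
  have hfd := differentiableAt_of_contDiffOn hU hf (hmaps hx)
  have h : fderiv ℝ (fun z => f (ψ z)) x = (fderiv ℝ f (ψ x)).comp (fderiv ℝ ψ x) :=
    fderiv_comp x hfd hd
  rw [partialDeriv, h, ContinuousLinearMap.comp_apply, fderiv_apply_eq_sum_partialDeriv]
  simp only [fderiv_single_apply hV hψ hx]

lemma SmoothMat.comp {X : EuclideanSpace ℝ (Fin n) → Matrix (Fin n) (Fin n) ℝ}
    (hX : SmoothMat U X) (hψ : ContDiffOn ℝ ∞ ψ V) (hmaps : Set.MapsTo ψ V U) :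
    SmoothMat V (fun z => X (ψ z)) := fun a b => (hX a b).comp hψ hmaps

lemma dMat_comp (hU : IsOpen U) (hV : IsOpen V) (hψ : ContDiffOn ℝ ∞ ψ V)
    (hmaps : Set.MapsTo ψ V U) {X : EuclideanSpace ℝ (Fin n) → Matrix (Fin n) (Fin n) ℝ}
    (hX : SmoothMat U X) (hx : x ∈ V) (i : Fin n) :
    dMat i (fun z => X (ψ z)) x = ∑ a, jacobiMat ψ x a i • dMat a X (ψ x) := by
  ext b c
  simp only [Matrix.sum_apply, Matrix.smul_apply, smul_eq_mul]
  exact partialDeriv_comp hU hV hψ hmaps (hX b c) hx i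

/-- `ψ` is a smooth map from `V` to `U` that pulls the metric `G` back to the metric `G'`. -/
structure IsIsometryOn (V U : Set (EuclideanSpace ℝ (Fin n)))
    (G' G : EuclideanSpace ℝ (Fin n) → Matrix (Fin n) (Fin n) ℝ)
    (ψ : EuclideanSpace ℝ (Fin n) → EuclideanSpace ℝ (Fin n)) : Prop where
  source : IsMetricOn V G'
  target : IsMetricOn U G
  smooth : ContDiffOn ℝ ∞ ψ V
  mapsTo : Set.MapsTo ψ V U
  pullback : ∀ x ∈ V, G' x = (jacobiMat ψ x).transpose * G (ψ x) * jacobiMat ψ x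

variable (G ψ) in
/-- The pulled back connection matrix in the direction `∂_i`. -/
def pullChr (i : Fin n) (x : EuclideanSpace ℝ (Fin n)) : Matrix (Fin n) (Fin n) ℝ :=
  ∑ a, jacobiMat ψ x a i • chrMat G a (ψ x)

namespace IsIsometryOn

variable (h : IsIsometryOn V U G' G ψ)
include h

lemma isUnit_det (hx : x ∈ V) : IsUnit (jacobiMat ψ x).det := by
  have hd := h.source.det_ne x hx
  rw [h.pullback x hx, Matrix.det_mul] at hd
  exact (right_ne_zero_of_mul hd).isUnit

lemma smooth_jacobi : SmoothMat V (jacobiMat ψ) := smooth_jacobiMat h.source.isOpen h.smooth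

lemma smooth_pullChr (i : Fin n) : SmoothMat V (pullChr G ψ i) :=
  SmoothMat.sum fun a => SmoothMat.smul (h.smooth_jacobi a i)
    ((h.target.smooth_chrMat a).comp h.smooth h.mapsTo)

/-- The transformation law of the Christoffel symbols. -/
lemma jacobi_mul_chrMat (hx : x ∈ V) (i : Fin n) :
    jacobiMat ψ x * chrMat G' i x
      = pullChr G ψ i x * jacobiMat ψ x + dMat i (jacobiMat ψ) x := by
  have hu := h.isUnit_det hx
  have hV := h.source.isOpen
  -- The transformed symbols are symmetric, as second derivatives of `ψ` commute, and compatible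
  -- with `G'`, by differentiating the pullback formula; uniqueness of the Levi-Civita connection
  -- identifies them.
  have key := h.source.chrMat_unique hx
    (C := fun i => (jacobiMat ψ x)⁻¹ * (pullChr G ψ i x * jacobiMat ψ x + dMat i (jacobiMat ψ) x))
    ?_ ?_ i
  · rw [key, ← mul_assoc, Matrix.mul_nonsing_inv _ hu, one_mul]
  · intro i l m
    have hs : ∀ a, (pullChr G ψ i x * jacobiMat ψ x + dMat i (jacobiMat ψ) x) a m
        = (pullChr G ψ m x * jacobiMat ψ x + dMat m (jacobiMat ψ) x) a i := by
      intro a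
      rw [Matrix.add_apply, Matrix.add_apply, dMat_jacobiMat_symm hV h.smooth hx i a m]
      congr 1
      simp only [pullChr, Matrix.mul_apply, Matrix.sum_apply, Matrix.smul_apply, smul_eq_mul,
        Finset.sum_mul]
      rw [Finset.sum_comm]
      refine Finset.sum_congr rfl fun b _ => Finset.sum_congr rfl fun c _ => ?_
      rw [h.target.chrMat_symm (h.mapsTo hx) b a c]
      ring
    rw [Matrix.mul_apply, Matrix.mul_apply]
    exact Finset.sum_congr rfl fun a _ => by rw [hs]
  · intro k
    have hJ := h.smooth_jacobi
    have hGψ := h.target.smooth.comp h.smooth h.mapsTo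
    have hdG : dMat k (fun z => G (ψ z)) x
        = (pullChr G ψ k x).transpose * G (ψ x) + G (ψ x) * pullChr G ψ k x := by
      rw [dMat_comp h.target.isOpen hV h.smooth h.mapsTo h.target.smooth hx]
      simp only [h.target.dMat_metric (h.mapsTo hx), pullChr, Matrix.transpose_sum,
        Matrix.transpose_smul, Finset.sum_mul, Finset.mul_sum, smul_add, Finset.sum_add_distrib,
        smul_mul_assoc, mul_smul_comm]
    have hJC : ∀ Z : Matrix (Fin n) (Fin n) ℝ, jacobiMat ψ x * ((jacobiMat ψ x)⁻¹ * Z) = Z := by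
      intro Z
      rw [← mul_assoc, Matrix.mul_nonsing_inv _ hu, one_mul]
    have hJC' : ∀ Z : Matrix (Fin n) (Fin n) ℝ,
        ((jacobiMat ψ x)⁻¹ * Z).transpose * (jacobiMat ψ x).transpose = Z.transpose := by
      intro Z
      rw [← Matrix.transpose_mul, hJC]
    rw [dMat_congr hV h.pullback hx, dMat_mul hV (hJ.transpose.mul hGψ) hJ hx,
      dMat_mul hV hJ.transpose hGψ hx, dMat_transpose, hdG, h.pullback x hx,
      ← mul_assoc, ← mul_assoc, hJC', mul_assoc (_ * _) (jacobiMat ψ x), hJC]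
    simp only [Matrix.transpose_add, Matrix.transpose_mul]
    noncomm_ring

/-- The transformation law of the curvature. -/
lemma jacobi_mul_curvMat (hx : x ∈ V) (i j : Fin n) :
    jacobiMat ψ x * curvMat G' i j x
      = (∑ a, ∑ b, (jacobiMat ψ x a i * jacobiMat ψ x b j) • curvMat G a b (ψ x))
        * jacobiMat ψ x := by
  have hV := h.source.isOpen
  have hJ := h.smooth_jacobi
  have hd : ∀ k l, dMat k (jacobiMat ψ) x * chrMat G' l x
      + jacobiMat ψ x * dMat k (chrMat G' l) x
      = dMat k (pullChr G ψ l) x * jacobiMat ψ x + pullChr G ψ l x * dMat k (jacobiMat ψ) x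
        + dMat k (dMat l (jacobiMat ψ)) x := by
    intro k l
    rw [← dMat_mul hV hJ (h.source.smooth_chrMat l) hx,
      dMat_congr hV (fun z hz => h.jacobi_mul_chrMat hz l) hx,
      dMat_add hV ((h.smooth_pullChr l).mul hJ) (hJ.dMat hV l) hx,
      dMat_mul hV (h.smooth_pullChr l) hJ hx]
  have hP : ∀ k l, dMat k (pullChr G ψ l) x
      = ∑ a, dMat k (jacobiMat ψ) x a l • chrMat G a (ψ x)
        + ∑ b, ∑ a, (jacobiMat ψ x b k * jacobiMat ψ x a l) • dMat b (chrMat G a) (ψ x) := by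
    intro k l
    have hc := fun a => (h.target.smooth_chrMat a).comp h.smooth h.mapsTo
    have : dMat k (pullChr G ψ l) x
        = ∑ a, dMat k (fun z => jacobiMat ψ z a l • chrMat G a (ψ z)) x :=
      dMat_sum hV (fun a => SmoothMat.smul (hJ a l) (hc a)) hx k
    rw [this, Finset.sum_comm, ← Finset.sum_add_distrib]
    refine Finset.sum_congr rfl fun a _ => ?_
    rw [dMat_smul hV (hJ a l) (hc a) hx, dMat_comp h.target.isOpen hV h.smooth h.mapsTo
      (h.target.smooth_chrMat a) hx, Finset.smul_sum]
    congr 1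
    exact Finset.sum_congr rfl fun b _ => by rw [smul_smul, mul_comm]
  -- The curvature of the pulled back connection is the pulled back curvature: second derivatives of
  -- `ψ` enter symmetrically in `i`, `j` and drop out.
  have hcurv : (∑ a, ∑ b, (jacobiMat ψ x a i * jacobiMat ψ x b j) • curvMat G a b (ψ x))
      = dMat i (pullChr G ψ j) x - dMat j (pullChr G ψ i) x
        + (pullChr G ψ i x * pullChr G ψ j x - pullChr G ψ j x * pullChr G ψ i x) := by
    have hm : ∀ k l, pullChr G ψ k x * pullChr G ψ l x = ∑ a, ∑ b,
        (jacobiMat ψ x a k * jacobiMat ψ x b l) • (chrMat G a (ψ x) * chrMat G b (ψ x)) := by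
      intro k l
      simp only [pullChr, Finset.sum_mul, Finset.mul_sum, smul_mul_smul_comm]
      exact Finset.sum_comm
    have hs : ∀ a, dMat i (jacobiMat ψ) x a j = dMat j (jacobiMat ψ) x a i :=
      fun a => dMat_jacobiMat_symm hV h.smooth hx i a j
    rw [hP, hP, hm, hm]
    simp only [hs]
    rw [add_sub_add_left_eq_sub]
    have hsw : ∀ Z : Fin n → Fin n → Matrix (Fin n) (Fin n) ℝ,
        ∑ a, ∑ b, (jacobiMat ψ x a j * jacobiMat ψ x b i) • Z a b
          = ∑ a, ∑ b, (jacobiMat ψ x a i * jacobiMat ψ x b j) • Z b a := by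
      intro Z
      rw [Finset.sum_comm]
      exact Finset.sum_congr rfl fun a _ => Finset.sum_congr rfl fun b _ => by rw [mul_comm]
    rw [hsw, hsw]
    simp only [← Finset.sum_sub_distrib, ← Finset.sum_add_distrib, ← smul_sub, ← smul_add,
      ← curvMat_eq]
  have e1 : ∀ {k l}, jacobiMat ψ x * dMat k (chrMat G' l) x
      = dMat k (pullChr G ψ l) x * jacobiMat ψ x + pullChr G ψ l x * dMat k (jacobiMat ψ) x
        + dMat k (dMat l (jacobiMat ψ)) x - dMat k (jacobiMat ψ) x * chrMat G' l x :=
    fun {k l} => eq_sub_of_add_eq' (hd k l)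
  have e2 : ∀ k l, jacobiMat ψ x * (chrMat G' k x * chrMat G' l x)
      = pullChr G ψ k x * (pullChr G ψ l x * jacobiMat ψ x + dMat l (jacobiMat ψ) x)
        + dMat k (jacobiMat ψ) x * chrMat G' l x := by
    intro k l
    rw [← mul_assoc, h.jacobi_mul_chrMat hx k, add_mul, mul_assoc, h.jacobi_mul_chrMat hx l]
  rw [hcurv, curvMat_eq, mul_add, mul_sub, mul_sub, e1, e1, e2, e2,
    dMat_comm hV hJ hx i j]
  noncomm_ring

lemma ricMat_eq (hx : x ∈ V) :
    ricMat G' x = (jacobiMat ψ x).transpose * ricMat G (ψ x) * jacobiMat ψ x := by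
  have hu := h.isUnit_det hx
  have hF : ∀ i j, curvMat G' i j x = ∑ a, ∑ b, (jacobiMat ψ x a i * jacobiMat ψ x b j) •
      ((jacobiMat ψ x)⁻¹ * (curvMat G a b (ψ x) * jacobiMat ψ x)) := by
    intro i j
    have := congrArg (fun Z => (jacobiMat ψ x)⁻¹ * Z) (h.jacobi_mul_curvMat hx i j)
    simp only [← mul_assoc, Matrix.nonsing_inv_mul _ hu, one_mul] at this
    rw [this]
    simp only [Finset.mul_sum, Finset.sum_mul, mul_smul_comm, smul_mul_assoc, mul_assoc]
  ext i k
  have hcon : ∀ a (Z : Matrix (Fin n) (Fin n) ℝ),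
      ∑ j, jacobiMat ψ x a j * ((jacobiMat ψ x)⁻¹ * Z) j k = Z a k := by
    intro a Z
    rw [← Matrix.mul_apply, ← mul_assoc, Matrix.mul_nonsing_inv _ hu, one_mul]
  rw [h.source.ricMat_apply hx]
  calc ∑ j, curvMat G' j i x j k
      = ∑ a, ∑ b, jacobiMat ψ x b i * (curvMat G a b (ψ x) * jacobiMat ψ x) a k := by
        simp only [hF, Matrix.sum_apply, Matrix.smul_apply, smul_eq_mul]
        rw [Finset.sum_comm]
        refine Finset.sum_congr rfl fun a _ => ?_
        rw [Finset.sum_comm]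
        refine Finset.sum_congr rfl fun b _ => ?_
        rw [← hcon a (curvMat G a b (ψ x) * jacobiMat ψ x), Finset.mul_sum]
        exact Finset.sum_congr rfl fun j _ => by ring
    _ = ∑ b, jacobiMat ψ x b i * ∑ c, ricMat G (ψ x) b c * jacobiMat ψ x c k := by
        rw [Finset.sum_comm]
        refine Finset.sum_congr rfl fun b _ => ?_
        rw [← Finset.mul_sum]
        congr 1
        simp only [Matrix.mul_apply, h.target.ricMat_apply (h.mapsTo hx), Finset.sum_mul]
        exact Finset.sum_comm
    _ = _ := by
        rw [mul_assoc, Matrix.mul_apply]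
        simp only [Matrix.mul_apply, Matrix.transpose_apply]

/-- With one index raised, the transformation law is a similarity, so traces of powers are
independent of the chart. -/
lemma ricEnd_eq (hx : x ∈ V) :
    ricEnd G' x = (jacobiMat ψ x)⁻¹ * ricEnd G (ψ x) * jacobiMat ψ x := by
  have hu := h.isUnit_det hx
  have ht : IsUnit (jacobiMat ψ x).transpose.det := by rwa [Matrix.det_transpose]
  rw [ricEnd, ricEnd, h.ricMat_eq hx, h.pullback x hx, Matrix.mul_inv_rev, Matrix.mul_inv_rev]
  simp only [mul_assoc]
  rw [← mul_assoc ((jacobiMat ψ x).transpose)⁻¹, Matrix.nonsing_inv_mul _ ht, one_mul]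

lemma scalCurv_eq (hx : x ∈ V) : scalCurv G' x = scalCurv G (ψ x) := by
  rw [scalCurv, scalCurv, h.ricEnd_eq hx, Matrix.trace_mul_comm, ← mul_assoc,
    Matrix.mul_nonsing_inv _ (h.isUnit_det hx), one_mul]

lemma ricNormSq_eq (hx : x ∈ V) : ricNormSq G' x = ricNormSq G (ψ x) := by
  have hu := h.isUnit_det hx
  have : ricEnd G' x * ricEnd G' x
      = (jacobiMat ψ x)⁻¹ * (ricEnd G (ψ x) * ricEnd G (ψ x) * jacobiMat ψ x) := by
    rw [h.ricEnd_eq hx]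
    simp only [mul_assoc]
    rw [← mul_assoc (jacobiMat ψ x) (jacobiMat ψ x)⁻¹, Matrix.mul_nonsing_inv _ hu, one_mul]
  rw [ricNormSq, ricNormSq, this, Matrix.trace_mul_comm, mul_assoc,
    Matrix.mul_nonsing_inv _ hu, mul_one]

end IsIsometryOn

end CoordinateChange

/-! ### Eigenvalue inequalities -/

section Eigenvalues

/-- If the sum of the `k` smallest values of a nondecreasing `μ` is nonnegative, then a weighted sum
of `μ` with weights in `[0, W]` of total mass exceeding `k W` is nonpositive only if `0 ≤ μ`. -/
lemma nonneg_of_weighted_sum_nonpos {N : ℕ} {μ v : Fin N → ℝ} (hμ : Monotone μ) {k κ W : ℝ}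
    (hk : 0 < k) (hkκ : k < κ) (hW : 0 < W) (hv0 : ∀ i, 0 ≤ v i) (hvW : ∀ i, v i ≤ W)
    (hv : ∑ i, v i = κ * W) (hsum : ∑ i, v i * μ i ≤ 0)
    (hnonneg : 0 ≤ ((List.ofFn μ).take ⌊k⌋₊).sum + (k - ⌊k⌋₊) * (List.ofFn μ).getD ⌊k⌋₊ 0)
    (i : Fin N) : 0 ≤ μ i := by
  -- Weights at most `W` with total κW need at least κ > k indices, so position ⌊k⌋₊ exists and the
  -- default value of `getD` is never read.
  have hκN : κ ≤ N := by
    have h : ∑ i, v i ≤ ∑ _i : Fin N, W := Finset.sum_le_sum fun i _ => hvW i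
    rw [hv, Finset.sum_const, Finset.card_univ, Fintype.card_fin, nsmul_eq_mul] at h
    exact le_of_mul_le_mul_right h hW
  have hfl : (⌊k⌋₊ : ℝ) ≤ k := Nat.floor_le hk.le
  have hm : ⌊k⌋₊ < N := by exact_mod_cast (by linarith : (⌊k⌋₊ : ℝ) < N)
  set m := ⌊k⌋₊ with hmdef
  set θ := μ ⟨m, hm⟩ with hθ
  have hget : (List.ofFn μ).getD m 0 = θ := by
    simp [List.getD_eq_getElem?_getD, hm, hθ]
  rw [hget, List.sum_take_ofFn] at hnonneg
  set S := ∑ j with j.val < m, μ j with hS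
  have hle : ∀ j : Fin N, j.val < m → μ j ≤ θ := fun j hj => hμ (Fin.le_def.2 hj.le)
  have hge : ∀ j : Fin N, ¬ j.val < m → θ ≤ μ j := fun j hj => hμ (Fin.le_def.2 (not_lt.1 hj))
  have hcard : (∑ j : Fin N with j.val < m, (1 : ℝ)) = m := by
    rw [Finset.sum_const, nsmul_eq_mul, mul_one]
    have : (Finset.univ.filter fun j : Fin N => j.val < m).card = m := by
      rw [Fin.card_filter_val_lt]
      exact min_eq_right hm.le
    rw [this]
  have hSθ : S ≤ m * θ := by
    rw [← hcard, Finset.sum_mul, hS]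
    exact Finset.sum_le_sum fun j hj => by
      rw [one_mul]
      exact hle j (Finset.mem_filter.1 hj).2
  -- From S ≤ mθ follows 0 ≤ S + (k - m)θ ≤ kθ.
  have hθ0 : 0 ≤ θ := by
    by_contra! hneg
    nlinarith
  -- Bathtub comparison: against μ - θ, the weight `W` on the first `m` indices is the cheapest
  -- choice. It gives W(S + θ(κ - m)) ≤ ∑ v_j μ_j ≤ 0, and comparison with S + θ(k - m) ≥ 0 forces θ
  -- = 0.
  have hkey : 0 ≤ ∑ j, (v j - if j.val < m then W else 0) * (μ j - θ) := by
    refine Finset.sum_nonneg fun j _ => ?_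
    split_ifs with hj
    · exact mul_nonneg_of_nonpos_of_nonpos (by linarith [hvW j]) (by linarith [hle j hj])
    · exact mul_nonneg (by linarith [hv0 j]) (by linarith [hge j hj])
  have hexp : ∑ j, (v j - if j.val < m then W else 0) * (μ j - θ)
      = ∑ j, v j * μ j - θ * (κ * W) - W * S + W * θ * m := by
    rw [← hv, ← hcard, hS, Finset.mul_sum, Finset.mul_sum, Finset.mul_sum, Finset.sum_filter,
      Finset.sum_filter, ← Finset.sum_sub_distrib, ← Finset.sum_sub_distrib,
      ← Finset.sum_add_distrib]
    refine Finset.sum_congr rfl fun j _ => ?_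
    split_ifs <;> ring
  rw [hexp] at hkey
  have hθ' : θ = 0 := by
    have h1 : W * (S + θ * (κ - m)) ≤ 0 := by linarith
    have h2 : S + θ * (κ - m) ≤ 0 := by
      by_contra! h
      linarith [mul_pos hW h]
    have h3 : θ * (κ - k) ≤ 0 := by linarith
    by_contra hne
    linarith [mul_pos (lt_of_le_of_ne hθ0 (Ne.symm hne)) (sub_pos.2 hkκ)]
  by_cases hi : i.val < m
  · have hS0 : S = 0 :=
      le_antisymm (by rw [hθ'] at hSθ; linarith) (by rw [hθ'] at hnonneg; linarith)
    have hz := (Finset.sum_eq_zero_iff_of_nonpos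
      (s := Finset.univ.filter fun j : Fin N => j.val < m) (f := μ)
      fun j hj => (hle j (Finset.mem_filter.1 hj).2).trans hθ'.le).1 hS0
    exact (hz i (Finset.mem_filter.2 ⟨Finset.mem_univ _, hi⟩)).ge
  · exact hθ' ▸ hge i hi

variable {V : Type*} [NormedAddCommGroup V] [InnerProductSpace ℝ V] [FiniteDimensional ℝ V]

/-- Both lists are sorted and have the same multiset of entries; `Fin.rev` is needed because the
spectral theorem lists eigenvalues in nonincreasing order. -/
lemma orderedEigenvalues_eq {T : Module.End ℝ V} (hT : LinearMap.IsSymmetric T) :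
    orderedEigenvalues T = List.ofFn fun i => hT.eigenvalues rfl (Fin.rev i) := by
  have hmono : Monotone fun i => hT.eigenvalues rfl (Fin.rev i) :=
    (hT.eigenvalues_antitone rfl).comp Fin.rev_anti
  refine List.Perm.eq_of_pairwise (le := (· ≤ ·)) (fun _ _ _ _ => le_antisymm)
    (Multiset.pairwise_sort _ _) ?_ ?_
  · exact (List.sortedLE_ofFn_iff.2 hmono).pairwise
  · rw [← Multiset.coe_eq_coe, orderedEigenvalues, Multiset.sort_eq,
      hT.roots_charpoly_eq_eigenvalues rfl, ← Fin.univ_val_map]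
    have hrev := congrArg Finset.val (Finset.map_univ_equiv (Fin.revPerm (n := Module.finrank ℝ V)))
    rw [Finset.map_val] at hrev
    conv_lhs => rw [← hrev, Multiset.map_map]
    refine Multiset.map_congr rfl fun i _ => ?_
    simp

/-- A `k`-nonnegative symmetric operator is nonnegative as soon as its weighted trace over a
family of vectors of total mass exceeding `k W` and frame bound `W` is nonpositive. -/
lemma nonneg_of_isKNonnegative {T : Module.End ℝ V} (hT : LinearMap.IsSymmetric T) {k κ W : ℝ}
    (hk : 0 < k) (hkκ : k < κ) (hW : 0 < W) (hnonneg : IsKNonnegative k T)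
    {ι : Type*} [Fintype ι] {c : ι → ℝ} {w : ι → V} (hc : ∀ a, 0 ≤ c a)
    (hframe : ∀ u, ∑ a, c a * inner ℝ (w a) u ^ 2 ≤ W * inner ℝ u u)
    (htotal : ∑ a, c a * inner ℝ (w a) (w a) = κ * W)
    (hsum : ∑ a, c a * inner ℝ (T (w a)) (w a) ≤ 0) (u : V) : 0 ≤ inner ℝ (T u) u := by
  set b := hT.eigenvectorBasis rfl with hb
  set μ : Fin (Module.finrank ℝ V) → ℝ := hT.eigenvalues rfl with hμ
  have hquad : ∀ u, inner ℝ (T u) u = ∑ i, μ i * inner ℝ (b i) u ^ 2 := by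
    intro u
    rw [← b.sum_inner_mul_inner (T u) u]
    refine Finset.sum_congr rfl fun i _ => ?_
    rw [hT u (b i), hT.apply_eigenvectorBasis, inner_smul_right, real_inner_comm u (b i)]
    simp only [RCLike.ofReal_real_eq_id, id_eq, hμ]
    ring
  have hnorm : ∀ u, inner ℝ u u = ∑ i, inner ℝ (b i) u ^ 2 := by
    intro u
    rw [← b.sum_inner_mul_inner u u]
    exact Finset.sum_congr rfl fun i _ => by rw [real_inner_comm u (b i), sq]
  have hmono : Monotone fun i => μ (Fin.rev i) :=
    (hT.eigenvalues_antitone rfl).comp Fin.rev_anti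
  -- The weight that the family places on each eigenvector. The frame bound on unit vectors gives
  -- v_i ≤ W, and Parseval gives the total mass.
  set v : Fin (Module.finrank ℝ V) → ℝ := fun i => ∑ a, c a * inner ℝ (w a) (b i) ^ 2 with hv
  have hmu : ∀ i, 0 ≤ μ (Fin.rev i) := by
    refine nonneg_of_weighted_sum_nonpos (v := fun i => v (Fin.rev i)) hmono hk hkκ hW
      (fun i => Finset.sum_nonneg fun a _ => mul_nonneg (hc a) (sq_nonneg _)) (fun i => ?_) ?_ ?_ ?_
    · have := hframe (b (Fin.rev i))
      rwa [real_inner_self_eq_norm_sq, b.norm_eq_one, one_pow, mul_one] at this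
    · rw [show ∑ i, v (Fin.rev i) = ∑ i, v i from Equiv.sum_comp Fin.revPerm v, ← htotal, hv,
        Finset.sum_comm]
      refine Finset.sum_congr rfl fun a _ => ?_
      rw [hnorm, Finset.mul_sum]
      exact Finset.sum_congr rfl fun i _ => by rw [real_inner_comm]
    · refine le_trans (le_of_eq ?_) hsum
      rw [show ∑ i, v (Fin.rev i) * μ (Fin.rev i) = ∑ i, v i * μ i from
        Equiv.sum_comp Fin.revPerm fun i => v i * μ i]
      simp only [hv, Finset.sum_mul]
      rw [Finset.sum_comm]
      refine Finset.sum_congr rfl fun a _ => ?_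
      rw [hquad, Finset.mul_sum]
      refine Finset.sum_congr rfl fun i _ => ?_
      rw [real_inner_comm (b i)]
      ring
    · rw [IsKNonnegative, orderedEigenvalues_eq hT] at hnonneg
      exact hnonneg
  rw [hquad]
  refine Finset.sum_nonneg fun i _ => mul_nonneg ?_ (sq_nonneg _)
  simpa using hmu (Fin.rev i)

end Eigenvalues

/-! ### The Bochner curvature term and the curvature operator of the second kind -/

section SecondKind

variable {n : ℕ}

/-- The Frobenius inner product on trace-free symmetric matrices. -/
@[reducible]
def tracelessSymCore (n : ℕ) : InnerProductSpace.Core ℝ (tracelessSym n) where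
  inner A B := ∑ i, ∑ j, A.1 i j * B.1 i j
  conj_inner_symm A B := by simp [mul_comm]
  re_inner_nonneg A := show (0 : ℝ) ≤ ∑ i, ∑ j, A.1 i j * A.1 i j from
    Finset.sum_nonneg fun i _ => Finset.sum_nonneg fun j _ => mul_self_nonneg _
  add_left A B C := by simp [add_mul, Finset.sum_add_distrib]
  smul_left A B r := by simp [Finset.mul_sum, mul_assoc]
  definite A hA := by
    have h1 := (Finset.sum_eq_zero_iff_of_nonneg fun i _ =>
      Finset.sum_nonneg fun j _ => mul_self_nonneg _).1 hA
    ext i j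
    have h2 := (Finset.sum_eq_zero_iff_of_nonneg fun j _ => mul_self_nonneg _).1
      (h1 i (Finset.mem_univ i)) j (Finset.mem_univ j)
    simpa using h2

variable {R : Fin n → Fin n → Fin n → Fin n → ℝ}

/-- The quadratic form of the curvature operator of the second kind. -/
lemma sum_secondKind_mul (R : Fin n → Fin n → Fin n → Fin n → ℝ) (h u : tracelessSym n) :
    ∑ k, ∑ l, (secondKind R h).1 k l * u.1 k l
      = ∑ k, ∑ l, ∑ i, ∑ j, R k i j l * h.1 i j * u.1 k l := by
  have h1 : ∑ k, ∑ l, (secondKind R h).1 k l * u.1 k l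
      = ∑ k, ∑ l, rBar R h.1 k l * u.1 k l := by
    have e : ∀ k l, (secondKind R h).1 k l
        = rBar R h.1 k l - (rBar R h.1).trace / n * (1 : Matrix (Fin n) (Fin n) ℝ) k l :=
      fun k l => rfl
    -- The part removed by the projection is a multiple of the identity, hence orthogonal to
    -- trace-free `u`.
    have ht : ∑ k, ∑ l, (1 : Matrix (Fin n) (Fin n) ℝ) k l * u.1 k l = 0 := by
      simpa [Matrix.one_apply, Matrix.trace] using u.2.2
    simp only [e, sub_mul, Finset.sum_sub_distrib, mul_assoc]
    simp only [← Finset.mul_sum]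
    rw [ht, mul_zero, sub_zero]
  have h2 : ∑ k, ∑ l, ∑ i, ∑ j, R k i j l * h.1 i j * u.1 k l
      = ∑ k, ∑ l, ∑ i, ∑ j, R l i j k * h.1 i j * u.1 k l := by
    rw [Finset.sum_comm]
    refine Finset.sum_congr rfl fun k _ => Finset.sum_congr rfl fun l _ =>
      Finset.sum_congr rfl fun i _ => Finset.sum_congr rfl fun j _ => ?_
    rw [u.2.1.apply]
  rw [h1, ← add_halves (∑ k, ∑ l, ∑ i, ∑ j, R k i j l * h.1 i j * u.1 k l)]
  nth_rewrite 2 [h2]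
  simp only [rBar, LinearMap.coe_mk, AddHom.coe_mk, Matrix.of_apply, Finset.sum_div,
    ← Finset.sum_add_distrib, Finset.mul_sum, Finset.sum_mul]
  refine Finset.sum_congr rfl fun k _ => Finset.sum_congr rfl fun l _ =>
    Finset.sum_congr rfl fun i _ => Finset.sum_congr rfl fun j _ => ?_
  ring

/-- The symmetric matrix `e_i ⊙ e_j`, for `i ≠ j`, and `0` for `i = j`. -/
def symUnit (i j : Fin n) : tracelessSym n :=
  -- The value 0 on the diagonal lets later sums run over all ordered pairs.
  if h : i = j then 0 else
    ⟨Matrix.single i j 1 + Matrix.single j i 1, by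
      refine ⟨?_, ?_⟩
      · rw [Matrix.IsSymm, Matrix.transpose_add, Matrix.transpose_single, Matrix.transpose_single,
          add_comm]
      · rw [Matrix.trace_add, Matrix.trace_single_eq_of_ne _ _ _ h,
          Matrix.trace_single_eq_of_ne _ _ _ (Ne.symm h), add_zero]⟩

lemma symUnit_self (i : Fin n) : symUnit i i = 0 := by simp [symUnit]

lemma sum_symUnit_mul {i j : Fin n} (hij : i ≠ j) (u : Fin n → Fin n → ℝ) :
    ∑ a, ∑ b, (symUnit i j).1 a b * u a b = u i j + u j i := by
  have h : ∀ p q : Fin n, ∑ a, ∑ b, Matrix.single p q (1 : ℝ) a b * u a b = u p q := by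
    intro p q
    rw [Finset.sum_eq_single p, Finset.sum_eq_single q]
    · simp
    · intro b _ hb
      simp [hb.symm]
    · simp
    · intro a _ ha
      simp [ha.symm]
    · simp
  simp only [symUnit, hij, dite_false, Matrix.add_apply, add_mul, Finset.sum_add_distrib, h]

lemma symUnit_apply {i j : Fin n} (hij : i ≠ j) (a b : Fin n) :
    (symUnit i j).1 a b = Matrix.single i j (1 : ℝ) a b + Matrix.single j i 1 a b := by
  simp [symUnit, hij]

variable (hleft : ∀ i j k l, R i j k l = -R j i k l) (hright : ∀ i j k l, R i j k l = -R i j l k)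
include hleft

/-- Only R_ijij and R_jiji survive, the other terms having equal first two indices. Nonnegativity of
R̊ thus implies nonnegative sectional curvature. -/
lemma sum_secondKind_symUnit {i j : Fin n} (hij : i ≠ j) (hsec : R i j i j = R j i j i) :
    ∑ k, ∑ l, (secondKind R (symUnit i j)).1 k l * (symUnit i j).1 k l = 2 * R i j i j := by
  have h0 : ∀ a b c, R a a b c = 0 := fun a b c => by linarith [hleft a a b c]
  have e : ∀ k l, ∑ a, ∑ b, R k a b l * (symUnit i j).1 a b * (symUnit i j).1 k l
      = (symUnit i j).1 k l * (R k i j l + R k j i l) := by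
    intro k l
    rw [← sum_symUnit_mul hij fun a b => R k a b l, Finset.mul_sum]
    refine Finset.sum_congr rfl fun a _ => ?_
    rw [Finset.mul_sum]
    exact Finset.sum_congr rfl fun b _ => by ring
  rw [sum_secondKind_mul]
  simp only [e]
  rw [sum_symUnit_mul hij fun k l => R k i j l + R k j i l, h0, h0, ← hsec]
  ring

include hright

/-- The algebraic core: if the curvature operator of the second kind is `k`-nonnegative for some
`k < n` and the Bochner curvature term of the Ricci tensor is nonpositive, then all Ricci
eigenvalues agree. -/
theorem ricci_eigenvalues_eq {k : ℝ} (hk : 0 < k) (hkn : k < n)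
    (hnonneg : IsKNonnegative k (secondKind R)) {ρ : Fin n → ℝ}
    (hρ : ∀ i, ρ i = ∑ j, R i j i j)
    (hQ : ∑ i, ∑ j, R i j i j * (ρ i - ρ j) ^ 2 ≤ 0) (i : Fin n) :
    ρ i = (∑ j, ρ j) / n := by
  have hn0 : (0 : ℝ) < n := hk.trans hkn
  have h0 : ∀ a b c, R a a b c = 0 := fun a b c => by linarith [hleft a a b c]
  have hboth : ∀ a b c d, R a b c d = R b a d c := fun a b c d => by
    rw [hleft, hright b a, neg_neg]
  set s := (∑ j, ρ j) / n with hs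
  set ν : Fin n → ℝ := fun j => ρ j - s with hν
  have hνsum : ∑ j, ν j = 0 := by
    simp only [hν, Finset.sum_sub_distrib, Finset.sum_const, Finset.card_univ, Fintype.card_fin,
      nsmul_eq_mul, hs]
    field_simp
    ring
  set W := ∑ j, ν j ^ 2 with hWdef
  have hW0 : 0 ≤ W := Finset.sum_nonneg fun j _ => sq_nonneg _
  suffices hWz : W = 0 by
    have := (Finset.sum_eq_zero_iff_of_nonneg fun j _ => sq_nonneg (ν j)).1 hWz i
      (Finset.mem_univ i)
    have : ν i = 0 := by simpa using this
    simpa [hν, sub_eq_zero] using this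
  by_contra hWne
  have hWpos : 0 < W := lt_of_le_of_ne hW0 (Ne.symm hWne)
  let h : tracelessSym n := ⟨Matrix.diagonal ν, Matrix.isSymm_diagonal ν, by
    rw [Matrix.trace_diagonal]; exact hνsum⟩
  have hdiag : ∀ u : Fin n → Fin n → ℝ, ∑ a, ∑ b, h.1 a b * u a b = ∑ a, ν a * u a a := by
    intro u
    refine Finset.sum_congr rfl fun a _ => ?_
    rw [Finset.sum_eq_single a]
    · simp [h]
    · intro b _ hb
      simp [h, Matrix.diagonal_apply_ne _ hb.symm]
    · simp
  have hTh : ∑ a, ∑ b, (secondKind R h).1 a b * h.1 a b = -∑ a, ∑ b, R a b a b * (ν a * ν b) := by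
    rw [sum_secondKind_mul]
    have e : ∀ a b, ∑ c, ∑ d, R a c d b * h.1 c d * h.1 a b
        = h.1 a b * ∑ c, ν c * R a c c b := by
      intro a b
      rw [← hdiag fun c d => R a c d b, Finset.mul_sum]
      refine Finset.sum_congr rfl fun c _ => ?_
      rw [Finset.mul_sum]
      exact Finset.sum_congr rfl fun d _ => by ring
    simp only [e]
    rw [hdiag fun a b => ∑ c, ν c * R a c c b, ← Finset.sum_neg_distrib]
    refine Finset.sum_congr rfl fun a _ => ?_
    rw [Finset.mul_sum, ← Finset.sum_neg_distrib]
    refine Finset.sum_congr rfl fun c _ => ?_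
    rw [hright a c c a]
    ring
  -- Half of `hQ`: the differences of ρ are those of ν; the squares produce Ricci eigenvalues and
  -- the cross term produces the quadratic form at `h`.
  have hbochner : ∑ a, ρ a * ν a ^ 2 + ∑ a, ∑ b, (secondKind R h).1 a b * h.1 a b ≤ 0 := by
    have e1 : ∑ a, ρ a * ν a ^ 2 = ∑ a, ∑ b, R a b a b * ν a ^ 2 :=
      Finset.sum_congr rfl fun a _ => by rw [hρ, Finset.sum_mul]
    have e2 : ∑ a, ∑ b, R a b a b * ν a ^ 2 = ∑ a, ∑ b, R a b a b * ν b ^ 2 := by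
      rw [Finset.sum_comm]
      exact Finset.sum_congr rfl fun a _ => Finset.sum_congr rfl fun b _ => by rw [hboth]
    have e3 : ∑ a, ∑ b, R a b a b * (ρ a - ρ b) ^ 2
        = ∑ a, ∑ b, R a b a b * ν a ^ 2 + ∑ a, ∑ b, R a b a b * ν b ^ 2
          - 2 * ∑ a, ∑ b, R a b a b * (ν a * ν b) := by
      simp only [Finset.mul_sum, ← Finset.sum_add_distrib, ← Finset.sum_sub_distrib]
      refine Finset.sum_congr rfl fun a _ => Finset.sum_congr rfl fun b _ => ?_
      simp only [hν]
      ring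
    rw [hTh, e1]
    linarith
  -- The norm is built over the existing group and module structure, so `hnonneg` still speaks of
  -- the same endomorphism.
  let _ : NormedAddCommGroup (tracelessSym n) := (tracelessSymCore n).toNormedAddCommGroup
  let _ : InnerProductSpace ℝ (tracelessSym n) :=
    InnerProductSpace.ofCore (tracelessSymCore n).toCore
  have hinner : ∀ A B : tracelessSym n, inner ℝ A B = ∑ a, ∑ b, A.1 a b * B.1 a b :=
    fun _ _ => rfl
  have hT : LinearMap.IsSymmetric (secondKind R) := by
    intro A B
    rw [hinner, real_inner_comm, hinner, sum_secondKind_mul, sum_secondKind_mul, sum_comm_pairs]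
    refine Finset.sum_congr rfl fun a _ => Finset.sum_congr rfl fun b _ =>
      Finset.sum_congr rfl fun c _ => Finset.sum_congr rfl fun d _ => ?_
    rw [hboth c a b d]
    ring
  have hsec : ∀ a b, a ≠ b → inner ℝ (secondKind R (symUnit a b)) (symUnit a b)
      = 2 * R a b a b :=
    fun a b hab => sum_secondKind_symUnit hleft hab (hboth a b a b)
  have hsec' : ∀ a b, inner ℝ (secondKind R (symUnit a b)) (symUnit a b) = 2 * R a b a b := by
    intro a b
    by_cases hab : a = b
    · subst hab
      rw [symUnit_self, map_zero, inner_zero_left, h0, mul_zero]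
    · exact hsec a b hab
  have hsymIn : ∀ a b (u : tracelessSym n), inner ℝ (symUnit a b) u
      = if a = b then 0 else 2 * u.1 a b := by
    intro a b u
    split_ifs with hab
    · subst hab
      rw [symUnit_self, inner_zero_left]
    · rw [hinner, sum_symUnit_mul hab u.1, u.2.1.apply a b]
      ring
  have hhIn : ∀ u : tracelessSym n, inner ℝ h u = ∑ a, ν a * u.1 a a :=
    fun u => (hinner h u).trans (hdiag u.1)
  have hpsd : ∀ u : tracelessSym n, 0 ≤ inner ℝ (secondKind R u) u := by
    -- `none` carries `h` with weight 1, and each ordered pair carries e_a ⊙ e_b with weight ν_a²/2.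
    -- The total mass is W + (n - 1)W, so κ = n.
    refine nonneg_of_isKNonnegative (κ := n) (W := W) hT hk hkn hWpos hnonneg
      (ι := Option (Fin n × Fin n))
      (c := fun o => o.elim 1 fun p => ν p.1 ^ 2 / 2)
      (w := fun o => o.elim h fun p => symUnit p.1 p.2) ?_ ?_ ?_ ?_
    · rintro (_ | p)
      · exact zero_le_one
      · exact div_nonneg (sq_nonneg _) zero_le_two
    · intro u
      simp only [Fintype.sum_option, Option.elim, Fintype.sum_prod_type, one_mul, hhIn, hsymIn,
        hinner u u]
      have hcs : (∑ a, ν a * u.1 a a) ^ 2 ≤ W * ∑ a, u.1 a a ^ 2 :=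
        Finset.sum_mul_sq_le_sq_mul_sq _ _ _
      have hpair : ∀ a b : Fin n, a ≠ b → ν a ^ 2 + ν b ^ 2 ≤ W := by
        intro a b hab
        rw [hWdef, ← Finset.sum_pair (f := fun j => ν j ^ 2) hab]
        exact Finset.sum_le_sum_of_subset_of_nonneg (Finset.subset_univ _)
          fun j _ _ => sq_nonneg _
      -- Symmetry of `u` allows ν_a² to be averaged with ν_b²; only their sum over a ≠ b is bounded
      -- with the sharp constant `W`.
      have hsw : ∑ a, ∑ b, ν a ^ 2 / 2 * (if a = b then 0 else 2 * u.1 a b) ^ 2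
          = ∑ a, ∑ b, ν b ^ 2 / 2 * (if a = b then 0 else 2 * u.1 a b) ^ 2 := by
        rw [Finset.sum_comm]
        refine Finset.sum_congr rfl fun a _ => Finset.sum_congr rfl fun b _ => ?_
        rw [u.2.1.apply a b]
        simp only [eq_comm]
      have hoff : ∑ a, ∑ b, ν a ^ 2 / 2 * (if a = b then 0 else 2 * u.1 a b) ^ 2
          ≤ ∑ a, ∑ b, W * (if a = b then 0 else u.1 a b * u.1 a b) := by
        rw [← add_halves (∑ a, ∑ b, ν a ^ 2 / 2 * (if a = b then 0 else 2 * u.1 a b) ^ 2)]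
        nth_rewrite 2 [hsw]
        simp only [Finset.sum_div, ← Finset.sum_add_distrib]
        refine Finset.sum_le_sum fun a _ => Finset.sum_le_sum fun b _ => ?_
        split_ifs with hab
        · simp
        · nlinarith [mul_le_mul_of_nonneg_right (hpair a b hab) (mul_self_nonneg (u.1 a b))]
      have hsplit : W * ∑ a, ∑ b, u.1 a b * u.1 a b
          = W * ∑ a, u.1 a a ^ 2 + ∑ a, ∑ b, W * (if a = b then 0 else u.1 a b * u.1 a b) := by
        simp only [← Finset.mul_sum]
        rw [← mul_add, ← Finset.sum_add_distrib]
        congr 1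
        refine Finset.sum_congr rfl fun a _ => ?_
        rw [← Finset.add_sum_erase _ _ (Finset.mem_univ a),
          ← Finset.add_sum_erase (Finset.univ) (fun b => if a = b then 0 else u.1 a b * u.1 a b)
            (Finset.mem_univ a), if_pos rfl, zero_add, sq]
        congr 1
        exact Finset.sum_congr rfl fun b hb => by
          rw [if_neg (Finset.ne_of_mem_erase hb).symm]
      rw [hsplit]
      exact add_le_add hcs hoff
    · simp only [Fintype.sum_option, Option.elim, Fintype.sum_prod_type, one_mul, hhIn, hsymIn]
      have e1 : ∑ a, ν a * h.1 a a = W := by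
        rw [hWdef]
        exact Finset.sum_congr rfl fun a _ => by simp [h, sq]
      have e2 : ∀ a b : Fin n, (ν a ^ 2 / 2 * if a = b then 0 else 2 * (symUnit a b).1 a b)
          = ν a ^ 2 - if a = b then ν a ^ 2 else 0 := by
        intro a b
        split_ifs with hab
        · simp
        · rw [symUnit_apply hab]
          simp [hab]
      simp only [e1, e2, Finset.sum_sub_distrib, Finset.sum_ite_eq, Finset.mem_univ, if_true,
        Finset.sum_const, Finset.card_univ, Fintype.card_fin, nsmul_eq_mul, ← Finset.mul_sum]
      rw [← hWdef]
      ring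
    · simp only [Fintype.sum_option, Option.elim, Fintype.sum_prod_type, one_mul, hsec']
      refine le_trans (le_of_eq ?_) hbochner
      rw [add_comm, ← hinner]
      congr 1
      refine Finset.sum_congr rfl fun a _ => ?_
      rw [hρ, Finset.sum_mul]
      exact Finset.sum_congr rfl fun b _ => by ring
  have hK : ∀ a b, 0 ≤ R a b a b := fun a b => by linarith [hpsd (symUnit a b), hsec' a b]
  have hρ0 : ∀ a, 0 ≤ ρ a := fun a => by rw [hρ]; exact Finset.sum_nonneg fun b _ => hK a b
  have hsum0 : ∑ a, ρ a * ν a ^ 2 = 0 := by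
    refine le_antisymm ?_ (Finset.sum_nonneg fun a _ => mul_nonneg (hρ0 a) (sq_nonneg _))
    have := hpsd h
    rw [hinner] at this
    linarith
  have hz : ∀ a, ρ a * ν a = 0 := by
    intro a
    have := (Finset.sum_eq_zero_iff_of_nonneg
      fun a _ => mul_nonneg (hρ0 a) (sq_nonneg (ν a))).1 hsum0 a (Finset.mem_univ a)
    rcases mul_eq_zero.1 this with h1 | h1
    · rw [h1, zero_mul]
    · rw [pow_eq_zero_iff two_ne_zero] at h1
      rw [h1, mul_zero]
  apply hWne
  -- ρ = ν + s and ∑ ν = 0, so the vanishing products ρ_a ν_a sum to `W`.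
  have e : ∑ a, ρ a * ν a = W + s * ∑ a, ν a := by
    rw [hWdef, Finset.mul_sum, ← Finset.sum_add_distrib]
    refine Finset.sum_congr rfl fun a _ => ?_
    simp only [hν]
    ring
  rw [hνsum, mul_zero, add_zero, Finset.sum_eq_zero fun a _ => hz a] at e
  exact e.symm

end SecondKind

/-! ### Simultaneous diagonalization -/

section Diagonalization

variable {n : ℕ}

lemma exists_orthogonal_diagonal {S : Matrix (Fin n) (Fin n) ℝ} (hS : S.IsSymm) :
    ∃ (Q : Matrix (Fin n) (Fin n) ℝ) (d : Fin n → ℝ),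
      Q.transpose * Q = 1 ∧ Q.transpose * S * Q = Matrix.diagonal d := by
  have hH : S.IsHermitian := by
    rwa [Matrix.IsHermitian, Matrix.conjTranspose_eq_transpose_of_trivial]
  refine ⟨hH.eigenvectorUnitary.1, hH.eigenvalues, ?_, ?_⟩
  · have := hH.eigenvectorUnitary.2.1
    rwa [Matrix.star_eq_conjTranspose, Matrix.conjTranspose_eq_transpose_of_trivial] at this
  · have := hH.conjStarAlgAut_star_eigenvectorUnitary
    simp only [Unitary.conjStarAlgAut_apply, Unitary.coe_star,
      Matrix.star_eq_conjTranspose, Matrix.conjTranspose_eq_transpose_of_trivial,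
      Matrix.transpose_transpose] at this
    rw [this]
    congr 1

/-- A positive definite and a symmetric form have a common orthogonal basis. -/
lemma exists_frame_diagonal {P S : Matrix (Fin n) (Fin n) ℝ} (hP : P.PosDef) (hS : S.IsSymm) :
    ∃ (A : Matrix (Fin n) (Fin n) ℝ) (d : Fin n → ℝ),
      A.transpose * P * A = 1 ∧ A.transpose * S * A = Matrix.diagonal d := by
  have hPs : P.IsSymm := by
    have := hP.isHermitian
    rwa [Matrix.IsHermitian, Matrix.conjTranspose_eq_transpose_of_trivial] at this
  obtain ⟨Q, p, hQ, hQP⟩ := exists_orthogonal_diagonal hPs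
  have hp : ∀ i, 0 < p i := by
    have hQinj : Function.Injective Q.mulVec := by
      apply Function.LeftInverse.injective (g := Q.transpose.mulVec)
      intro v
      rw [Matrix.mulVec_mulVec, hQ, Matrix.one_mulVec]
    have h := hP.conjTranspose_mul_mul_same hQinj
    rw [Matrix.conjTranspose_eq_transpose_of_trivial, hQP] at h
    exact Matrix.posDef_diagonal_iff.1 h
  -- `B` makes `P` the identity; a further orthogonal change preserves this while diagonalizing `S`.
  set B := Q * Matrix.diagonal fun i => (√(p i))⁻¹ with hB
  have hBP : B.transpose * P * B = 1 := by
    have : B.transpose * P * B = (Matrix.diagonal fun i => (√(p i))⁻¹)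
        * (Q.transpose * P * Q) * Matrix.diagonal fun i => (√(p i))⁻¹ := by
      rw [hB, Matrix.transpose_mul, Matrix.diagonal_transpose]
      simp only [mul_assoc]
    rw [this, hQP, Matrix.diagonal_mul_diagonal, Matrix.diagonal_mul_diagonal,
      ← Matrix.diagonal_one]
    congr 1
    ext i
    have h1 := Real.mul_self_sqrt (hp i).le
    have h2 := (Real.sqrt_pos.2 (hp i)).ne'
    nth_rewrite 2 [← h1]
    field_simp
  clear_value B
  have hBS : (B.transpose * S * B).IsSymm := by
    rw [Matrix.IsSymm, Matrix.transpose_mul, Matrix.transpose_mul, Matrix.transpose_transpose,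
      hS.eq, mul_assoc]
  obtain ⟨O, d, hO, hOd⟩ := exists_orthogonal_diagonal hBS
  refine ⟨B * O, d, ?_, ?_⟩
  · rw [Matrix.transpose_mul]
    calc O.transpose * B.transpose * P * (B * O)
        = O.transpose * (B.transpose * P * B) * O := by simp only [mul_assoc]
      _ = 1 := by rw [hBP, mul_one, hO]
  · rw [← hOd, Matrix.transpose_mul]
    simp only [mul_assoc]

/-- Equality in the Cauchy-Schwarz inequality `(tr H)² ≤ n tr H²` for `H = P⁻¹ S`. -/
lemma eq_smul_of_trace_sq_le (hn : n ≠ 0) {P S : Matrix (Fin n) (Fin n) ℝ} (hP : P.PosDef)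
    (hS : S.IsSymm)
    (h : (P⁻¹ * S * (P⁻¹ * S)).trace ≤ (P⁻¹ * S).trace ^ 2 / n) :
    S = ((P⁻¹ * S).trace / n) • P := by
  have hn0 : (n : ℝ) ≠ 0 := Nat.cast_ne_zero.2 hn
  obtain ⟨A, d, hAP, hAS⟩ := exists_frame_diagonal hP hS
  have hA1 : IsUnit A.det := by
    have := congrArg Matrix.det hAP
    rw [Matrix.det_mul, Matrix.det_one] at this
    exact (right_ne_zero_of_mul (this ▸ one_ne_zero)).isUnit
  have hAt : IsUnit A.transpose.det := by rwa [Matrix.det_transpose]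
  have hinv : P⁻¹ = A * A.transpose := by
    refine Matrix.inv_eq_left_inv ?_
    have h1 : A.transpose * P = A⁻¹ := (Matrix.inv_eq_left_inv hAP).symm
    rw [mul_assoc, h1, Matrix.mul_nonsing_inv _ hA1]
  have ht1 : (P⁻¹ * S).trace = ∑ i, d i := by
    rw [hinv, mul_assoc, Matrix.trace_mul_comm, hAS, Matrix.trace_diagonal]
  have ht2 : (P⁻¹ * S * (P⁻¹ * S)).trace = ∑ i, d i ^ 2 := by
    have : P⁻¹ * S * (P⁻¹ * S) = A * (A.transpose * S * A * (A.transpose * S)) := by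
      rw [hinv]; simp only [mul_assoc]
    rw [this, Matrix.trace_mul_comm, mul_assoc, hAS, Matrix.diagonal_mul_diagonal,
      Matrix.trace_diagonal]
    simp only [sq]
  set c := (∑ i, d i) / n with hc
  have hd : ∀ i, d i = c := by
    -- The variance ∑ (d_i - c)² equals ∑ d_i² - (∑ d_i)²/n.
    have hsq : ∑ i, (d i - c) ^ 2 ≤ 0 := by
      have e : ∑ i, (d i - c) ^ 2 = ∑ i, d i ^ 2 - 2 * c * ∑ i, d i + n * c ^ 2 := by
        have : (n : ℝ) * c ^ 2 = ∑ _i : Fin n, c ^ 2 := by simp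
        rw [this, Finset.mul_sum, ← Finset.sum_sub_distrib, ← Finset.sum_add_distrib]
        exact Finset.sum_congr rfl fun i _ => by ring
      rw [ht1, ht2] at h
      rw [e]
      have e2 : (∑ i, d i) ^ 2 / n = 2 * c * ∑ i, d i - n * c ^ 2 := by
        rw [hc]; field_simp; ring
      linarith
    intro i
    have h0 := (Finset.sum_eq_zero_iff_of_nonneg fun i _ => sq_nonneg (d i - c)).1
      (le_antisymm hsq (Finset.sum_nonneg fun i _ => sq_nonneg _)) i (Finset.mem_univ i)
    exact sub_eq_zero.1 (by simpa using h0)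
  rw [ht1, ← hc]
  have hS' : A.transpose * S * A = A.transpose * (c • P) * A := by
    rw [hAS, mul_smul_comm, smul_mul_assoc, hAP, show d = fun _ => c from funext hd]
    ext i j
    simp [Matrix.diagonal_apply, Matrix.one_apply]
  have h2 := congrArg (fun Z => A.transpose⁻¹ * (Z * A⁻¹)) hS'
  simp only [mul_assoc] at h2
  rwa [Matrix.mul_nonsing_inv _ hA1, mul_one, mul_one, ← mul_assoc, ← mul_assoc,
    Matrix.nonsing_inv_mul _ hAt, one_mul, one_mul] at h2

end Diagonalization

/-! ### The metric in smooth charts -/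

section Charts

variable {n : ℕ} {M : Type*} [TopologicalSpace M] [ChartedSpace (EuclideanSpace ℝ (Fin n)) M]
  [IsManifold (𝓡 n) ∞ M]
  (g : Bundle.ContMDiffRiemannianMetric (𝓡 n) ∞ (EuclideanSpace ℝ (Fin n))
    (TangentSpace (𝓡 n) : M → Type _))
  {φ φ' : OpenPartialHomeomorph M (EuclideanSpace ℝ (Fin n))}

/-- The metric in a chart, as a bilinear form. -/
def chartForm (φ : OpenPartialHomeomorph M (EuclideanSpace ℝ (Fin n)))
    (y u v : EuclideanSpace ℝ (Fin n)) : ℝ :=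
  g.inner (φ.symm y) (mfderiv (𝓡 n) (𝓡 n) φ.symm y u) (mfderiv (𝓡 n) (𝓡 n) φ.symm y v)

lemma chartForm_eq_sum (φ : OpenPartialHomeomorph M (EuclideanSpace ℝ (Fin n)))
    (y u v : EuclideanSpace ℝ (Fin n)) :
    chartForm g φ y u v = ∑ i, ∑ j, u i * v j * metricCoeff g φ y i j := by
  let D : EuclideanSpace ℝ (Fin n) →L[ℝ] EuclideanSpace ℝ (Fin n) :=
    mfderiv (𝓡 n) (𝓡 n) φ.symm y
  let b : EuclideanSpace ℝ (Fin n) →L[ℝ] EuclideanSpace ℝ (Fin n) →L[ℝ] ℝ := g.inner (φ.symm y)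
  let B : EuclideanSpace ℝ (Fin n) →L[ℝ] EuclideanSpace ℝ (Fin n) →L[ℝ] ℝ := b.bilinearComp D D
  have hdecomp : ∀ w : EuclideanSpace ℝ (Fin n),
      w = ∑ i, w i • EuclideanSpace.single i (1 : ℝ) := by
    intro w
    ext j
    simp [Finset.sum_apply, Pi.single_apply]
  change B u v = _
  conv_lhs => rw [hdecomp u, hdecomp v]
  simp only [map_sum, map_smul, sum_apply, smul_apply, smul_eq_mul,
    Finset.mul_sum]
  refine (Finset.sum_comm).trans ?_
  refine Finset.sum_congr rfl fun i _ => Finset.sum_congr rfl fun j _ => ?_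
  have : B (EuclideanSpace.single i 1) (EuclideanSpace.single j 1) = metricCoeff g φ y i j := rfl
  rw [this]
  ring

lemma metricCoeff_isSymm (φ : OpenPartialHomeomorph M (EuclideanSpace ℝ (Fin n)))
    (y : EuclideanSpace ℝ (Fin n)) : (metricCoeff g φ y).IsSymm := by
  ext i j
  exact g.symm _ _ _

omit [IsManifold (𝓡 n) ∞ M] in
lemma mdifferentiable_of_mem_maximalAtlas (hφ : φ ∈ IsManifold.maximalAtlas (𝓡 n) ∞ M) :
    φ.MDifferentiable (𝓡 n) (𝓡 n) :=
  ⟨(contMDiffOn_of_mem_maximalAtlas hφ).mdifferentiableOn (by simp),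
    (contMDiffOn_symm_of_mem_maximalAtlas hφ).mdifferentiableOn (by simp)⟩

lemma metricCoeff_posDef (hφ : φ ∈ IsManifold.maximalAtlas (𝓡 n) ∞ M)
    {y : EuclideanSpace ℝ (Fin n)} (hy : y ∈ φ.target) : (metricCoeff g φ y).PosDef := by
  refine Matrix.PosDef.of_dotProduct_mulVec_pos ?_ fun {x} hx => ?_
  · rw [Matrix.IsHermitian, Matrix.conjTranspose_eq_transpose_of_trivial]
    exact metricCoeff_isSymm g φ y
  · have hinj := (mdifferentiable_of_mem_maximalAtlas hφ).symm.mfderiv_injective (x := y) hy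
    have hx' : (WithLp.toLp 2 x : EuclideanSpace ℝ (Fin n)) ≠ 0 := by simpa using hx
    have hne : mfderiv (𝓡 n) (𝓡 n) φ.symm y (WithLp.toLp 2 x : EuclideanSpace ℝ (Fin n)) ≠ 0 :=
      fun h0 => hx' (hinj (h0.trans (map_zero _).symm))
    have hpos := g.pos _ _ hne
    have heq := chartForm_eq_sum g φ y (WithLp.toLp 2 x) (WithLp.toLp 2 x)
    rw [chartForm] at heq
    rw [heq] at hpos
    refine hpos.trans_le (le_of_eq ?_)
    simp only [dotProduct, Matrix.mulVec, star_trivial, Finset.mul_sum]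
    exact Finset.sum_congr rfl fun i _ => Finset.sum_congr rfl fun j _ => by ring

lemma contDiffOn_metricCoeff (hφ : φ ∈ IsManifold.maximalAtlas (𝓡 n) ∞ M) :
    SmoothMat φ.target (metricCoeff g φ) := by
  have hsymm : ContMDiffOn (𝓡 n) (𝓡 n) ∞ φ.symm φ.target :=
    contMDiffOn_symm_of_mem_maximalAtlas hφ
  -- Coordinate fields are the tangent map of the inverse chart applied to constant fields, hence
  -- smooth along it.
  have hvec : ∀ i : Fin n, ContMDiffOn (𝓡 n) ((𝓡 n).prod 𝓘(ℝ, EuclideanSpace ℝ (Fin n))) ∞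
      (fun y => Bundle.TotalSpace.mk' (EuclideanSpace ℝ (Fin n))
        (E := (TangentSpace (𝓡 n) : M → Type _)) (φ.symm y)
        (mfderiv (𝓡 n) (𝓡 n) φ.symm y (EuclideanSpace.single i (1 : ℝ)))) φ.target := by
    intro i
    have h1 := hsymm.contMDiffOn_tangentMapWithin (m := ∞) (by simp) φ.open_target.uniqueMDiffOn
    have h2 : ContMDiff (𝓡 n) (𝓡 n).tangent ∞
        (fun y : EuclideanSpace ℝ (Fin n) =>
          (⟨y, EuclideanSpace.single i (1 : ℝ)⟩ :
            TangentBundle (𝓡 n) (EuclideanSpace ℝ (Fin n)))) :=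
      contMDiff_vectorSpace_iff_contDiff.2 contDiff_const
    refine (h1.comp h2.contMDiffOn fun y hy => hy).congr fun y hy => ?_
    simp only [Function.comp, tangentMapWithin, mfderivWithin_of_isOpen φ.open_target hy]
  intro i j
  rw [← contMDiffOn_iff_contDiffOn]
  have h : ContMDiffOn (𝓡 n) ((𝓡 n).prod 𝓘(ℝ)) ∞
      (fun y => Bundle.TotalSpace.mk' ℝ (E := Bundle.Trivial M ℝ) (φ.symm y)
        (g.inner (φ.symm y)
          (mfderiv (𝓡 n) (𝓡 n) φ.symm y (EuclideanSpace.single i (1 : ℝ)))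
          (mfderiv (𝓡 n) (𝓡 n) φ.symm y (EuclideanSpace.single j (1 : ℝ))))) φ.target := by
    apply ContMDiffOn.clm_bundle_apply₂ (F₁ := EuclideanSpace ℝ (Fin n))
      (F₂ := EuclideanSpace ℝ (Fin n))
    · exact g.contMDiff.comp_contMDiffOn hsymm
    · exact hvec i
    · exact hvec j
  intro y hy
  have hy' := h y hy
  simp only [Bundle.contMDiffWithinAt_totalSpace] at hy'
  exact hy'.2

lemma isMetricOn_metricCoeff (hφ : φ ∈ IsManifold.maximalAtlas (𝓡 n) ∞ M) :
    IsMetricOn φ.target (metricCoeff g φ) where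
  isOpen := φ.open_target
  smooth := contDiffOn_metricCoeff g hφ
  symm y _ := metricCoeff_isSymm g φ y
  det_ne _ hy := (metricCoeff_posDef g hφ hy).det_pos.ne'

/-- The base points φ'⁻¹(x) and φ⁻¹(ψ(x)) are equal but not definitionally so; all tangent spaces
share one model space, so the same vectors can be used at both. -/
lemma inner_congr {p q : M} (h : p = q) (u v : EuclideanSpace ℝ (Fin n)) :
    g.inner p (u : TangentSpace (𝓡 n) p) (v : TangentSpace (𝓡 n) p)
      = g.inner q (u : TangentSpace (𝓡 n) q) (v : TangentSpace (𝓡 n) q) := by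
  subst h
  rfl

lemma IsMetricOn.mono {U V : Set (EuclideanSpace ℝ (Fin n))}
    {G : EuclideanSpace ℝ (Fin n) → Matrix (Fin n) (Fin n) ℝ} (hG : IsMetricOn U G)
    (hV : IsOpen V) (hVU : V ⊆ U) : IsMetricOn V G where
  isOpen := hV
  smooth a b := (hG.smooth a b).mono hVU
  symm y hy := hG.symm y (hVU hy)
  det_ne y hy := hG.det_ne y (hVU hy)

/-- Transition maps between charts are isometries. -/
lemma isIsometryOn_transition (hφ : φ ∈ IsManifold.maximalAtlas (𝓡 n) ∞ M)
    (hφ' : φ' ∈ IsManifold.maximalAtlas (𝓡 n) ∞ M) :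
    IsIsometryOn (φ'.symm.trans φ).source φ.target (metricCoeff g φ') (metricCoeff g φ)
      (fun x => φ (φ'.symm x)) := by
  have hV : IsOpen (φ'.symm.trans φ).source := (φ'.symm.trans φ).open_source
  have hmem : ∀ x ∈ (φ'.symm.trans φ).source, x ∈ φ'.target ∧ φ'.symm x ∈ φ.source := by
    intro x hx
    rw [OpenPartialHomeomorph.trans_source] at hx
    exact hx
  have hsm : ContDiffOn ℝ ∞ (fun x => φ (φ'.symm x)) (φ'.symm.trans φ).source := by
    rw [← contMDiffOn_iff_contDiffOn]
    exact (contMDiffOn_of_mem_maximalAtlas hφ).comp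
      ((contMDiffOn_symm_of_mem_maximalAtlas hφ').mono fun x hx => (hmem x hx).1)
      fun x hx => (hmem x hx).2
  refine ⟨(isMetricOn_metricCoeff g hφ').mono hV fun x hx => (hmem x hx).1,
    isMetricOn_metricCoeff g hφ, hsm, fun x hx => φ.map_source (hmem x hx).2, fun x hx => ?_⟩
  set ψ : EuclideanSpace ℝ (Fin n) → EuclideanSpace ℝ (Fin n) := fun x => φ (φ'.symm x) with hψ
  have hdψ : DifferentiableAt ℝ ψ x :=
    (hsm.contDiffAt (hV.mem_nhds hx)).differentiableAt (by simp)
  have hloc : φ'.symm =ᶠ[nhds x] φ.symm ∘ ψ := by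
    filter_upwards [hV.mem_nhds hx] with z hz
    exact (φ.left_inv (hmem z hz).2).symm
  have hd : ∀ u : EuclideanSpace ℝ (Fin n), mfderiv (𝓡 n) (𝓡 n) φ'.symm x u
      = mfderiv (𝓡 n) (𝓡 n) φ.symm (ψ x) (fderiv ℝ ψ x u) := by
    intro u
    have h1 : MDifferentiableAt (𝓡 n) (𝓡 n) φ.symm (ψ x) :=
      (mdifferentiable_of_mem_maximalAtlas hφ).mdifferentiableAt_symm (φ.map_source (hmem x hx).2)
    have h2 : MDifferentiableAt (𝓡 n) (𝓡 n) ψ x := hdψ.mdifferentiableAt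
    have h3 := mfderiv_comp x h1 h2
    rw [mfderiv_eq_fderiv] at h3
    rw [hloc.mfderiv_eq]
    exact DFunLike.congr_fun h3 u
  have hp : φ'.symm x = φ.symm (ψ x) := hloc.eq_of_nhds
  ext i j
  have hform : metricCoeff g φ' x i j
      = chartForm g φ (ψ x) (fderiv ℝ ψ x (EuclideanSpace.single i 1))
        (fderiv ℝ ψ x (EuclideanSpace.single j 1)) := by
    simp only [metricCoeff, Matrix.of_apply, chartForm]
    rw [hd, hd]
    exact inner_congr g hp _ _
  rw [hform, chartForm_eq_sum]
  simp only [fderiv_single_apply hV hsm hx, Matrix.mul_apply, Matrix.transpose_apply,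
    Finset.sum_mul]
  rw [Finset.sum_comm]
  exact Finset.sum_congr rfl fun a _ => Finset.sum_congr rfl fun b _ => by ring

lemma scalCurv_chart_eq (hφ : φ ∈ IsManifold.maximalAtlas (𝓡 n) ∞ M)
    (hφ' : φ' ∈ IsManifold.maximalAtlas (𝓡 n) ∞ M) {p : M} (hp : p ∈ φ.source)
    (hp' : p ∈ φ'.source) :
    scalCurv (metricCoeff g φ') (φ' p) = scalCurv (metricCoeff g φ) (φ p) := by
  have hx : φ' p ∈ (φ'.symm.trans φ).source := by
    rw [OpenPartialHomeomorph.trans_source]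
    exact ⟨φ'.map_source hp', by simpa [φ'.left_inv hp'] using hp⟩
  have h := (isIsometryOn_transition g hφ hφ').scalCurv_eq hx
  rwa [φ'.left_inv hp'] at h

lemma ricNormSq_chart_eq (hφ : φ ∈ IsManifold.maximalAtlas (𝓡 n) ∞ M)
    (hφ' : φ' ∈ IsManifold.maximalAtlas (𝓡 n) ∞ M) {p : M} (hp : p ∈ φ.source)
    (hp' : p ∈ φ'.source) :
    ricNormSq (metricCoeff g φ') (φ' p) = ricNormSq (metricCoeff g φ) (φ p) := by
  have hx : φ' p ∈ (φ'.symm.trans φ).source := by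
    rw [OpenPartialHomeomorph.trans_source]
    exact ⟨φ'.map_source hp', by simpa [φ'.left_inv hp'] using hp⟩
  have h := (isIsometryOn_transition g hφ hφ').ricNormSq_eq hx
  rwa [φ'.left_inv hp'] at h

/-- Linear coordinates can be chosen such that the metric is the identity and the Ricci tensor is
diagonal at a given point. -/
lemma exists_chart_diagonal (hφ : φ ∈ IsManifold.maximalAtlas (𝓡 n) ∞ M) {p : M}
    (hp : p ∈ φ.source) :
    ∃ φ' ∈ IsManifold.maximalAtlas (𝓡 n) ∞ M, p ∈ φ'.source ∧ metricCoeff g φ' (φ' p) = 1 ∧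
      ∃ d : Fin n → ℝ, ricMat (metricCoeff g φ') (φ' p) = Matrix.diagonal d := by
  have hG := isMetricOn_metricCoeff g hφ
  have hy : φ p ∈ φ.target := φ.map_source hp
  obtain ⟨A, d, hA, hAd⟩ :=
    exists_frame_diagonal (metricCoeff_posDef g hφ hy) (hG.ricMat_symm hy)
  have hdet : IsUnit A.det := by
    have := congrArg Matrix.det hA
    rw [Matrix.det_mul, Matrix.det_one] at this
    exact (right_ne_zero_of_mul (this ▸ one_ne_zero)).isUnit
  have hmul : ∀ {B C : Matrix (Fin n) (Fin n) ℝ}, B * C = 1 → Function.LeftInverse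
      (Matrix.toEuclideanCLM (𝕜 := ℝ) B) (Matrix.toEuclideanCLM (𝕜 := ℝ) C) := by
    intro B C h v
    rw [← mul_apply_eq_comp, ← map_mul, h, map_one, one_apply_eq_self]
  -- Composing the chart with A⁻¹ makes the transition back to `φ` linear with Jacobi matrix `A`.
  let L : EuclideanSpace ℝ (Fin n) ≃L[ℝ] EuclideanSpace ℝ (Fin n) :=
    ContinuousLinearEquiv.equivOfInverse (Matrix.toEuclideanCLM (𝕜 := ℝ) A⁻¹)
      (Matrix.toEuclideanCLM (𝕜 := ℝ) A) (hmul (Matrix.mul_nonsing_inv _ hdet))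
      (hmul (Matrix.nonsing_inv_mul _ hdet))
  let φ' := φ.transHomeomorph L.toHomeomorph
  have hφ' : φ' ∈ IsManifold.maximalAtlas (𝓡 n) ∞ M := by
    refine OpenPartialHomeomorph.mem_maximalAtlas_of_contMDiffOn _ ?_ ?_
    · exact L.contDiff.contMDiff.comp_contMDiffOn (contMDiffOn_of_mem_maximalAtlas hφ)
    · exact (contMDiffOn_symm_of_mem_maximalAtlas hφ).comp
        L.symm.contDiff.contMDiff.contMDiffOn fun x hx => hx
  have hp' : p ∈ φ'.source := hp
  have hiso := isIsometryOn_transition g hφ hφ'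
  have hx : φ' p ∈ (φ'.symm.trans φ).source := by
    rw [OpenPartialHomeomorph.trans_source]
    exact ⟨φ'.map_source hp', by simpa [φ'.left_inv hp'] using hp⟩
  have hV := (φ'.symm.trans φ).open_source
  have hJ : jacobiMat (fun x => φ (φ'.symm x)) (φ' p) = A := by
    have hloc : (fun x => φ (φ'.symm x)) =ᶠ[nhds (φ' p)] L.symm := by
      filter_upwards [φ'.open_target.mem_nhds (φ'.map_source hp')] with z hz
      exact φ.right_inv hz
    ext a i
    rw [← fderiv_single_apply hV hiso.smooth hx, hloc.fderiv_eq, L.symm.fderiv]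
    have : L.symm (EuclideanSpace.single i 1) a
        = (A.mulVec (EuclideanSpace.single i (1 : ℝ)).ofLp) a := rfl
    exact this.trans (by simp)
  have hpull := hiso.pullback _ hx
  have hric := hiso.ricMat_eq hx
  simp only [hJ, φ'.left_inv hp'] at hpull hric
  exact ⟨φ', hφ', hp', hpull.trans hA, d, hric.trans hAd⟩

end Charts

/-! ### Global conclusion -/

section Global

variable {n : ℕ} {M : Type*} [TopologicalSpace M] [ChartedSpace (EuclideanSpace ℝ (Fin n)) M]
  [IsManifold (𝓡 n) ∞ M]
  (g : Bundle.ContMDiffRiemannianMetric (𝓡 n) ∞ (EuclideanSpace ℝ (Fin n))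
    (TangentSpace (𝓡 n) : M → Type _))
  {φ : OpenPartialHomeomorph M (EuclideanSpace ℝ (Fin n))}

/-- The scalar curvature as a function on the manifold. -/
def globalScal (p : M) : ℝ :=
  scalCurv (metricCoeff g (chartAt (EuclideanSpace ℝ (Fin n)) p))
    (chartAt (EuclideanSpace ℝ (Fin n)) p p)

/-- The squared norm of the Ricci tensor as a function on the manifold. -/
def globalRicNormSq (p : M) : ℝ :=
  ricNormSq (metricCoeff g (chartAt (EuclideanSpace ℝ (Fin n)) p))
    (chartAt (EuclideanSpace ℝ (Fin n)) p p)

lemma globalScal_eq (hφ : φ ∈ IsManifold.maximalAtlas (𝓡 n) ∞ M) {p : M} (hp : p ∈ φ.source) :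
    globalScal g p = scalCurv (metricCoeff g φ) (φ p) :=
  scalCurv_chart_eq g hφ (IsManifold.chart_mem_maximalAtlas p) hp (mem_chart_source _ p)

lemma globalRicNormSq_eq (hφ : φ ∈ IsManifold.maximalAtlas (𝓡 n) ∞ M) {p : M}
    (hp : p ∈ φ.source) : globalRicNormSq g p = ricNormSq (metricCoeff g φ) (φ p) :=
  ricNormSq_chart_eq g hφ (IsManifold.chart_mem_maximalAtlas p) hp (mem_chart_source _ p)

lemma continuous_globalRicNormSq : Continuous (globalRicNormSq g) := by
  rw [continuous_iff_continuousAt]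
  intro p
  set φ := chartAt (EuclideanSpace ℝ (Fin n)) p with hφdef
  have hφ : φ ∈ IsManifold.maximalAtlas (𝓡 n) ∞ M := IsManifold.chart_mem_maximalAtlas p
  have hp : p ∈ φ.source := mem_chart_source _ p
  have hc : ContinuousAt (fun q => ricNormSq (metricCoeff g φ) (φ q)) p := by
    have h1 := (isMetricOn_metricCoeff g hφ).smooth_ricNormSq.continuousOn.continuousAt
      (φ.open_target.mem_nhds (φ.map_source hp))
    exact ContinuousAt.comp (f := φ) h1 (φ.continuousAt hp)
  refine hc.congr ?_
  filter_upwards [φ.open_source.mem_nhds hp] with q hq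
  exact (globalRicNormSq_eq g hφ hq).symm

lemma isLocallyConstant_globalScal (hharm : HasHarmonicCurvature g) :
    IsLocallyConstant (globalScal g) := by
  rw [IsLocallyConstant.iff_eventually_eq]
  intro p
  set φ := chartAt (EuclideanSpace ℝ (Fin n)) p with hφdef
  have hφ : φ ∈ IsManifold.maximalAtlas (𝓡 n) ∞ M := IsManifold.chart_mem_maximalAtlas p
  have hp : p ∈ φ.source := mem_chart_source _ p
  have hG := isMetricOn_metricCoeff g hφ
  -- The chart target need not be connected; a ball in it is.
  obtain ⟨ε, hε, hball⟩ := Metric.isOpen_iff.1 φ.open_target (φ p) (φ.map_source hp)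
  have hconst : ∀ z ∈ Metric.ball (φ p) ε,
      scalCurv (metricCoeff g φ) z = scalCurv (metricCoeff g φ) (φ p) := by
    intro z hz
    refine Metric.isOpen_ball.is_const_of_fderiv_eq_zero (𝕜 := ℝ)
      (convex_ball (φ p) ε).isPreconnected (fun w hw => ?_) (fun w hw => ?_) hz
      (Metric.mem_ball_self hε)
    · exact (differentiableAt_of_contDiffOn hG.isOpen hG.smooth_scalCurv
        (hball hw)).differentiableWithinAt
    · ext v
      rw [fderiv_apply_eq_sum_partialDeriv]
      simp only [hG.partialDeriv_scalCurv (hharm φ hφ) (hball hw), mul_zero,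
        Finset.sum_const_zero]
      rfl
  filter_upwards [φ.open_source.mem_nhds hp,
    (φ.continuousAt hp).preimage_mem_nhds (Metric.ball_mem_nhds _ hε)] with q hq hq'
  rw [globalScal_eq g hφ hq, globalScal_eq g hφ hp]
  exact hconst _ hq'

lemma frameCurvature_one (G : EuclideanSpace ℝ (Fin n) → Matrix (Fin n) (Fin n) ℝ)
    (y : EuclideanSpace ℝ (Fin n)) :
    frameCurvature G 1 y = fun a b c d => curvature G a b c d y := by
  funext a b c d
  simp [frameCurvature, Matrix.one_apply]

/-- At a maximum point of the norm of the Ricci tensor, the Ricci tensor is a multiple of the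
metric. -/
lemma ricNormSq_eq_of_forall_le {k : ℝ} (hk : 0 < k) (hkn : k < n)
    (hharm : HasHarmonicCurvature g) (hnonneg : SecondKindKNonnegative g k) {p : M}
    (hmax : ∀ q, globalRicNormSq g q ≤ globalRicNormSq g p) :
    globalRicNormSq g p = globalScal g p ^ 2 / n := by
  obtain ⟨φ, hφ, hp, h1, d, hd⟩ := exists_chart_diagonal g
    (IsManifold.chart_mem_maximalAtlas (I := 𝓡 n) (n := ∞) p) (mem_chart_source _ p)
  have hG := isMetricOn_metricCoeff g hφ
  have hy := φ.map_source hp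
  have hlocal : IsLocalMax (ricNormSq (metricCoeff g φ)) (φ p) := by
    filter_upwards [φ.open_target.mem_nhds hy] with z hz
    have := hmax (φ.symm z)
    rwa [globalRicNormSq_eq g hφ (φ.map_target hz), globalRicNormSq_eq g hφ hp,
      φ.right_inv hz] at this
  have hQ := hG.bochner_nonpos_of_isLocalMax (hharm φ hφ) hy h1 hd hlocal
  -- The coordinate frame is itself orthonormal at this point, so A = 1 is admissible.
  have hK := hnonneg φ hφ (φ p) hy 1 (by rw [h1]; simp)
  rw [frameCurvature_one] at hK
  have hric : ∀ i, d i = ∑ j, curvature (metricCoeff g φ) i j i j (φ p) := by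
    intro i
    have h := congrFun (congrFun hd i) i
    rw [Matrix.diagonal_apply_eq] at h
    rw [← h]
    simp [ricMat, ricci, h1, Matrix.one_apply]
  have heq := ricci_eigenvalues_eq (fun i j k l => curvature_swap_left i j k l)
    (fun i j k l => hG.curvature_swap_right hy i j k l) hk hkn hK hric hQ
  have hE : ricEnd (metricCoeff g φ) (φ p) = Matrix.diagonal d := by
    rw [ricEnd, h1, hd, inv_one, one_mul]
  have hn0 : (n : ℝ) ≠ 0 := (hk.trans hkn).ne'
  rw [globalRicNormSq_eq g hφ hp, globalScal_eq g hφ hp, ricNormSq, scalCurv, hE,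
    Matrix.diagonal_mul_diagonal, Matrix.trace_diagonal, Matrix.trace_diagonal]
  have hsum : ∑ i, d i * d i = ∑ _i : Fin n, ((∑ j, d j) / n) * ((∑ j, d j) / n) :=
    Finset.sum_congr rfl fun i _ => by rw [heq i]
  rw [hsum, Finset.sum_const, Finset.card_univ, Fintype.card_fin, nsmul_eq_mul]
  field_simp

/-- Compact connected manifolds with harmonic curvature and `k`-nonnegative curvature operator of
the second kind, `0 < k < n`, are Einstein. -/
theorem isEinstein_of_secondKindKNonnegative [CompactSpace M] [ConnectedSpace M] {k : ℝ}
    (hk : 0 < k) (hkn : k < n) (hharm : HasHarmonicCurvature g)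
    (hnonneg : SecondKindKNonnegative g k) : IsEinstein g := by
  obtain ⟨p, -, hp⟩ := isCompact_univ.exists_isMaxOn (Set.univ_nonempty (α := M))
    (continuous_globalRicNormSq g).continuousOn
  have hmax : ∀ q, globalRicNormSq g q ≤ globalRicNormSq g p := fun q => hp (Set.mem_univ q)
  have hpeq := ricNormSq_eq_of_forall_le g hk hkn hharm hnonneg hmax
  have hn0 : n ≠ 0 := by
    rintro rfl
    exact absurd (hk.trans hkn) (by simp)
  refine ⟨globalScal g p / n, fun φ hφ y hy i j => ?_⟩
  have hq : φ.symm y ∈ φ.source := φ.map_target hy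
  have hscal : scalCurv (metricCoeff g φ) y = globalScal g p := by
    rw [(isLocallyConstant_globalScal g hharm).apply_eq_of_preconnectedSpace p (φ.symm y),
      globalScal_eq g hφ hq, φ.right_inv hy]
  -- Constancy of S carries the bound from the maximum point to every point.
  have hle : ricNormSq (metricCoeff g φ) y ≤ scalCurv (metricCoeff g φ) y ^ 2 / n := by
    have h := hmax (φ.symm y)
    rwa [globalRicNormSq_eq g hφ hq, φ.right_inv hy, hpeq, ← hscal] at h
  have h := eq_smul_of_trace_sq_le hn0 (metricCoeff_posDef g hφ hy)
    ((isMetricOn_metricCoeff g hφ).ricMat_symm hy) hle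
  have hij := congrFun (congrFun h i) j
  rw [← hscal]
  exact hij

end Global

end HarmonicCurvature

end

theorem theoremA {n : ℕ} (hn : 3 ≤ n) {M : Type*} [TopologicalSpace M] [T2Space M]
    [CompactSpace M] [ConnectedSpace M] [ChartedSpace (EuclideanSpace ℝ (Fin n)) M]
    [IsManifold (𝓡 n) ∞ M]
    (g : Bundle.ContMDiffRiemannianMetric (𝓡 n) ∞ (EuclideanSpace ℝ (Fin n))
      (TangentSpace (𝓡 n) : M → Type _))
    (hharm : HarmonicCurvature.HasHarmonicCurvature g)
    (hnonneg : HarmonicCurvature.SecondKindKNonnegative g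
      ((n : ℝ) * (n + 2) / (2 * (n + 1)))) :
    HarmonicCurvature.IsEinstein g := by
  have hn' : (3 : ℝ) ≤ n := by exact_mod_cast hn
  refine HarmonicCurvature.isEinstein_of_secondKindKNonnegative g (by positivity) ?_ hharm hnonneg
  -- The threshold is below `n` because n + 2 < 2(n + 1).
  rw [div_lt_iff₀ (by positivity)]
  nlinarith
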